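/- **Setting.** Let $\lambda>0$ and let $F,F_0$ be cumulative distribution functions on $\mathbb R$. An asset must be sold within a marketing period of length $t\ge 0$. Offers arrive as a Poisson process of rate $\lambda$: the durations $D_1,D_2,\dots$ between offers are exponential with rate $\lambda$, the offers $X_1,X_2,\dots$ have distribution function $F$, the residual price $X_0$ has distribution function $F_0$, and all these random variables are independent. The $n$-th offer arrives when the remaining time is $t_n=\max(t_{n-1}-D_n,0)$, $t_0=t$. A policy decides, from the remaining time $s>0$ and the offered price $x$, whether the offer is accepted, i.e. it is a measurable set of accepted pairs $(s,x)$. The sale price is the first offer accepted before the deadline, and it is $X_0$ if there is none. Let $\mu(t)$ be the maximal expected sale price over all policies (with an integrable sale price) when the remaining time is $t$. The optimal policy accepts an offer $x$ at remaining time $s$ if and only if $x\ge\mu(s)$, and $S_t$ denotes the sale price obtained over the marketing period $t$ with this policy. Let $X$ have distribution function $F$, and put $$\phi(x)=\int_x^\infty (1-F(u))\,du=E[(X-x)_+],\qquad M=\sup\{x: F(x)<1\},\qquad \mu_0=E[X_0].$$ Assume $E|X_0|<\infty$ and $0\le\mu_0<M<\infty$. **Theorem.** Assume that for some $p>0$,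 $c>0$, $$\lim_{x\to M-}\frac{\phi(x)}{(M-x)^{p+1}}=c .$$ For every $t\ge0$ the maximum $\mu(t)$ exists, and $E[S_t]=\mu(t)$. As $t\to\infty$, $$\mu(t)=M-\frac{1}{(\lambda pc)^{1/p}}\cdot\frac1{t^{1/p}}+o\!\left(\frac1{t^{1/p}}\right).$$ If moreover $E[X_0^2]<\infty$, then $E[S_t^2]<\infty$ for all $t\ge 0$ and, as $t\to\infty$ ($\sim$ means that the ratio tends to $1$): * if $p<1$, then $\int_{\mu_0}^{M}\frac{\mathrm{Var}[(X-w)_+]}{E[(X-w)_+]^2}\,dw<\infty$ and $$\mathrm{Var}[S_t]\sim \frac{1}{(\lambda p)^{\frac{p+1}{p}}c^{\frac1p}}\left[(M-\mu_0)+\frac{\mathrm{Var}[X_0]}{\phi(\mu_0)}+\int_{\mu_0}^{M}\frac{\mathrm{Var}[(X-w)_+]}{E[(X-w)_+]^2}\,dw\right]\cdot\frac{1}{t^{\frac{p+1}{p}}};$$ * if $p=1$, then $\displaystyle \mathrm{Var}[S_t]\sim\frac{2}{3\lambda^2c^2}\cdot\frac{\ln t}{t^2}$; * if $p>1$, then $\displaystyle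 \mathrm{Var}[S_t]\sim\frac{2}{(p-1)(p+2)}\cdot\frac{1}{(\lambda pc)^{2/p}}\cdot\frac{1}{t^{2/p}}$. -/

import Mathlib

open MeasureTheory ProbabilityTheory Filter Topology Asymptotics

noncomputable section

/-- The bidding process on a probability space `(Ω, P)`: offers arrive as a Poisson process of rate
`lam`, that is, the durations `D 0, D 1, …` between consecutive offers are exponential of rate
`lam`; the offers `X 0, X 1, …` have law `ν`; the residual price `X₀` has law `ν₀`; and all these
random variables are mutually independent (`D n` is independent of `X n`, the pairs `(D n, X n)`
are mutually independent, and `X₀` is independent of the whole sequence of pairs). -/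
structure BiddingProcess {Ω : Type*} [MeasurableSpace Ω] (P : Measure Ω) (lam : ℝ)
    (ν ν₀ : Measure ℝ) where
  /-- durations between consecutive offers -/
  D : ℕ → Ω → ℝ
  /-- successive price offers -/
  X : ℕ → Ω → ℝ
  /-- residual price, received when the deadline is reached -/
  X₀ : Ω → ℝ
  measurable_D : ∀ n, Measurable (D n)
  measurable_X : ∀ n, Measurable (X n)
  measurable_X₀ : Measurable X₀
  law_D : ∀ n, HasLaw (D n) (expMeasure lam) P
  law_X : ∀ n, HasLaw (X n) ν P
  law_X₀ : HasLaw X₀ ν₀ P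
  indep_D_X : ∀ n, IndepFun (D n) (X n) P
  indep_pairs : iIndepFun (fun n ω => (D n ω, X n ω)) P
  indep_X₀ : IndepFun X₀ (fun ω n => (D n ω, X n ω)) P

namespace BiddingProcess

variable {Ω : Type*} [MeasurableSpace Ω] {P : Measure Ω} {lam : ℝ} {ν ν₀ : Measure ℝ}

/-- `B.remaining t n ω` is the time remaining to the deadline when the `n`-th offer arrives
(offers counted from one; `n = 0` is the start of the process):
`t_0 = t` and `t_n = max (t_{n-1} - D_n) 0`. -/
def remaining (B : BiddingProcess P lam ν ν₀) (t : ℝ) : ℕ → Ω → ℝ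
  | 0, _ => t
  | n + 1, ω => max (B.remaining t n ω - B.D n ω) 0

/-- The policy `A` accepts the offer `X n`, and this offer arrives before the deadline. A policy is
a set of pairs (time remaining, offered price): those at which the offer is accepted. -/
def Accepts (B : BiddingProcess P lam ν ν₀) (A : Set (ℝ × ℝ)) (t : ℝ) (ω : Ω) (n : ℕ) : Prop :=
  0 < B.remaining t (n + 1) ω ∧ (B.remaining t (n + 1) ω, B.X n ω) ∈ A

open Classical in
/-- The realized sale price when the policy `A` is followed over a marketing period of length `t`:
the first accepted offer or, if no offer is accepted before the deadline, the residual price. -/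
def salePrice (B : BiddingProcess P lam ν ν₀) (A : Set (ℝ × ℝ)) (t : ℝ) (ω : Ω) : ℝ :=
  if h : ∃ n, B.Accepts A t ω n then B.X (Nat.find h) ω else B.X₀ ω

/-- The expected sale prices that can be achieved by some policy over a marketing period of
length `t`. (If the offers are bounded above and the residual price is integrable, then the positive
part of the sale price is always integrable, so that a policy whose sale price is not integrable
has expectation `-∞`.) -/
def achievable (B : BiddingProcess P lam ν ν₀) (t : ℝ) : Set ℝ :=
  {v | ∃ A : Set (ℝ × ℝ), MeasurableSet A ∧ Integrable (B.salePrice A t) P ∧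
    v = ∫ ω, B.salePrice A t ω ∂P}

/-- `μ(t)`: the maximal expected sale price when the time remaining is `t` and no offer
is in hand; this is the value of rejecting an offer at time `t` to the deadline. -/
def threshold (B : BiddingProcess P lam ν ν₀) (t : ℝ) : ℝ :=
  sSup (B.achievable t)

/-- The optimal policy: with time `s` remaining, accept the offer `x` if and only if
`x ≥ μ(s)`. -/
def optimalPolicy (B : BiddingProcess P lam ν ν₀) : Set (ℝ × ℝ) :=
  {q | B.threshold q.1 ≤ q.2}

/-- `S_t`: the realized sale price for the marketing period `t` under the optimal policy. -/
def optimalSalePrice (B : BiddingProcess P lam ν ν₀) (t : ℝ) : Ω → ℝ :=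
  B.salePrice B.optimalPolicy t

end BiddingProcess

/-- `φ(x) = ∫_x^∞ (1 - F(u)) du`, where `F` is the distribution function of `ν`. -/
def tailIntegral (ν : Measure ℝ) (x : ℝ) : ℝ :=
  ∫ u in Set.Ioi x, (1 - cdf ν u)

end

/-!
Write `φ x = E[(X - x)_+]` (`meanExcess`, equal to `tailIntegral`) and `ψ x = E[(X - x)_+ ^ 2]`
(`sqExcess`).

**The value.** Let `g` solve `g' = λ φ(g)`, `g 0 = μ₀`. Its inverse is `w ↦ ∫_{μ₀}^w du / (λ φ(u))`,
which maps `(-∞, M)` onto `ℝ` because `φ x ≤ M - x` (`exists_solution_autonomous`). By variation of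
constants, an equation `w' = λ (h - w)` says that `w s` is the mean of the payoff at the next offer,
where `h r` is the mean payoff of an offer arriving when `r` remains and `w` is the payoff of
rejecting it (`integral_thresholdPayoff`). For `g` this payoff is the larger one of the offer
and the value `g` of waiting. Hence, for every policy, the process equal to the sale price once the
asset is sold and to `g` of the remaining time before has nonincreasing mean, and constant mean for
the policy with reservation price `g`. The deadline is reached after finitely many offers and
the residual price is independent of the offers, so in the limit `E[sale price] ≤ g t`, with equality
for the reservation price `g` (`BiddingProcess.integral_comp_salePrice_le`,
`BiddingProcess.isGreatest_achievable`). Thus `g` is the threshold.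

**The variance.** The same argument applied to the square of the price shows that the variance `v`
solves `v' = λ (ψ(g) - P(X > g) v)`. Since `φ' = -P(X > ·)` away from the atoms of `X`, the
solution is `v = φ(g) K(g)` with `K' = ψ / φ ^ 2` and `K μ₀ = Var X₀ / φ μ₀`
(`BiddingProcess.integral_sq_salePrice`). The atoms matter only at countably many times.

**Asymptotics.** By L'Hôpital's rule at `M`, `t = ∫_{μ₀}^{g t} du / (λ φ(u))` gives
`M - g t ~ (λ p c t) ^ (-1 / p)`, `ψ x ~ 2 c (M - x) ^ (p + 2) / (p + 2)`, and therefore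
`K' x ~ 2 (M - x) ^ (-p) / (c (p + 2))`. So `K` converges if `p < 1`, grows like
`-2 log (M - x) / (3 c)` if `p = 1`, and like `2 (M - x) ^ (1 - p) / (c (p + 2) (p - 1))` if
`p > 1`; multiplying by `φ(g t) ~ c (M - g t) ^ (p + 1)` gives the three regimes.
-/

noncomputable section

/-! ### The Markov property of the bidding process and the verification inequality -/

namespace BiddingProcess

variable {Ω : Type*} [MeasurableSpace Ω] {P : Measure Ω} {lam : ℝ} {ν ν₀ : Measure ℝ}

/-- The information carried by the first `n` offers and their durations. -/
@[reducible] def past (B : BiddingProcess P lam ν ν₀) (n : ℕ) : MeasurableSpace Ω :=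
  ⨆ k ∈ Set.Iio n, MeasurableSpace.comap (fun ω => (B.D k ω, B.X k ω)) inferInstance

/-- The event that none of the first `n` offers has been accepted before the deadline. -/
def pending (B : BiddingProcess P lam ν ν₀) (A : Set (ℝ × ℝ)) (t : ℝ) (n : ℕ) : Set Ω :=
  {ω | ∀ k < n, ¬ B.Accepts A t ω k}

variable (B : BiddingProcess P lam ν ν₀) {A : Set (ℝ × ℝ)} {t : ℝ}

lemma measurable_pair (n : ℕ) : Measurable fun ω => (B.D n ω, B.X n ω) :=
  (B.measurable_D n).prodMk (B.measurable_X n)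

lemma past_mono : Monotone B.past := fun _ _ h =>
  biSup_mono fun _ hk => lt_of_lt_of_le hk h

lemma past_le (n : ℕ) : B.past n ≤ ‹MeasurableSpace Ω› :=
  iSup₂_le fun k _ => (B.measurable_pair k).comap_le

lemma measurable_pair_past (n : ℕ) : Measurable[B.past (n + 1)] fun ω => (B.D n ω, B.X n ω) :=
  Measurable.of_comap_le (le_iSup₂_of_le n (Nat.lt_succ_self n) le_rfl)

lemma measurable_remaining_past (t : ℝ) (n : ℕ) : Measurable[B.past n] (B.remaining t n) := by
  induction n with
  | zero => exact measurable_const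
  | succ n ih =>
    have h1 : Measurable[B.past (n + 1)] (B.remaining t n) :=
      ih.mono (B.past_mono n.le_succ) le_rfl
    have h2 : Measurable[B.past (n + 1)] (B.D n) := measurable_fst.comp (B.measurable_pair_past n)
    exact (h1.sub h2).max measurable_const

lemma measurable_remaining (t : ℝ) (n : ℕ) : Measurable (B.remaining t n) :=
  (B.measurable_remaining_past t n).mono (B.past_le n) le_rfl

lemma measurableSet_accepts_past (hA : MeasurableSet A) (t : ℝ) (n : ℕ) :
    MeasurableSet[B.past (n + 1)] {ω | B.Accepts A t ω n} := by
  have h1 := B.measurable_remaining_past t (n + 1)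
  have h2 : Measurable[B.past (n + 1)] (B.X n) := measurable_snd.comp (B.measurable_pair_past n)
  exact (h1 measurableSet_Ioi).inter ((h1.prodMk h2) hA)

lemma measurableSet_pending_past (hA : MeasurableSet A) (t : ℝ) (n : ℕ) :
    MeasurableSet[B.past n] (B.pending A t n) := by
  have : B.pending A t n = ⋂ k, ⋂ (_ : k < n), {ω | B.Accepts A t ω k}ᶜ := by
    ext ω; simp [pending]
  rw [this]
  refine MeasurableSet.iInter fun k => MeasurableSet.iInter fun hk => ?_
  exact B.past_mono hk _ (B.measurableSet_accepts_past hA t k).compl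

lemma measurableSet_pending (hA : MeasurableSet A) (t : ℝ) (n : ℕ) :
    MeasurableSet (B.pending A t n) :=
  B.past_le n _ (B.measurableSet_pending_past hA t n)

lemma measurableSet_accepts (hA : MeasurableSet A) (t : ℝ) (n : ℕ) :
    MeasurableSet {ω | B.Accepts A t ω n} :=
  B.past_le _ _ (B.measurableSet_accepts_past hA t n)

lemma indep_past (n : ℕ) :
    Indep (B.past n)
      (MeasurableSpace.comap (fun ω => (B.D n ω, B.X n ω)) inferInstance) P := by
  have h := indep_iSup_of_disjoint (fun k => (B.measurable_pair k).comap_le)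
    B.indep_pairs.iIndep (S := Set.Iio n) (T := {n}) (by simp)
  simpa [past] using h

lemma map_pair [IsProbabilityMeasure P] (n : ℕ) :
    P.map (fun ω => (B.D n ω, B.X n ω)) = (expMeasure lam).prod ν := by
  rw [(B.indep_D_X n).map_prod_eq_prod_map_map (B.measurable_D n).aemeasurable
    (B.measurable_X n).aemeasurable, (B.law_D n).map_eq, (B.law_X n).map_eq]

/-- The Markov property of the remaining time, on the event that no offer has been accepted so far:
the next duration and offer may be replaced by their expectation. -/
lemma setIntegral_pending_step [IsProbabilityMeasure P] [IsProbabilityMeasure (expMeasure lam)]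
    [IsProbabilityMeasure ν] (hA : MeasurableSet A) (t : ℝ) (n : ℕ)
    {Φ : ℝ → ℝ × ℝ → ℝ} (hΦ : Measurable fun q : ℝ × ℝ × ℝ => Φ q.1 q.2) {K : ℝ}
    (hK : ∀ s z, |Φ s z| ≤ K) {w : ℝ → ℝ}
    (hw : ∀ s, ∫ z, Φ s z ∂((expMeasure lam).prod ν) = w s) :
    ∫ ω in B.pending A t n, Φ (B.remaining t n ω) (B.D n ω, B.X n ω) ∂P =
      ∫ ω in B.pending A t n, w (B.remaining t n ω) ∂P := by
  set Y : Ω → ℝ × ℝ := fun ω => (B.remaining t n ω, (B.pending A t n).indicator 1 ω) with hY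
  have hYp : Measurable[B.past n] Y :=
    (B.measurable_remaining_past t n).prodMk
      (measurable_const.indicator (B.measurableSet_pending_past hA t n))
  have hYm : Measurable Y := hYp.mono (B.past_le n) le_rfl
  have hind : IndepFun Y (fun ω => (B.D n ω, B.X n ω)) P :=
    indep_of_indep_of_le_left (B.indep_past n) hYp.comap_le
  have hlaw := hind.map_prod_eq_prod_map_map hYm.aemeasurable (B.measurable_pair n).aemeasurable
  rw [B.map_pair n] at hlaw
  have : IsProbabilityMeasure (P.map Y) := Measure.isProbabilityMeasure_map hYm.aemeasurable
  set Ψ : (ℝ × ℝ) × (ℝ × ℝ) → ℝ := fun q => q.1.2 * Φ q.1.1 q.2 with hΨ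
  have hΨm : Measurable Ψ := by
    have : Measurable fun q : (ℝ × ℝ) × (ℝ × ℝ) => Φ q.1.1 q.2 :=
      hΦ.comp (f := fun q : (ℝ × ℝ) × (ℝ × ℝ) => (q.1.1, q.2)) (by fun_prop)
    exact (by fun_prop : Measurable fun q : (ℝ × ℝ) × (ℝ × ℝ) => q.1.2).mul this
  have hb : ∀ᵐ ω ∂P, ‖Ψ (Y ω, (B.D n ω, B.X n ω))‖ ≤ K := by
    refine Eventually.of_forall fun ω => ?_
    have h0 := hK (B.remaining t n ω) (B.D n ω, B.X n ω)
    simp only [hΨ, hY, Real.norm_eq_abs, abs_mul]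
    by_cases h : ω ∈ B.pending A t n
    · simpa [h] using h0
    · simpa [h] using (abs_nonneg _).trans h0
  have hYZ : Measurable fun ω => (Y ω, (B.D n ω, B.X n ω)) := hYm.prodMk (B.measurable_pair n)
  have hint : Integrable Ψ ((P.map Y).prod ((expMeasure lam).prod ν)) := by
    rw [← hlaw, integrable_map_measure hΨm.aestronglyMeasurable hYZ.aemeasurable]
    exact Integrable.of_bound (hΨm.comp hYZ).aestronglyMeasurable K hb
  have hwm : StronglyMeasurable w := by
    have : w = fun s => ∫ z, Φ s z ∂((expMeasure lam).prod ν) := by ext s; rw [hw]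
    rw [this]
    exact hΦ.stronglyMeasurable.integral_prod_right
  calc ∫ ω in B.pending A t n, Φ (B.remaining t n ω) (B.D n ω, B.X n ω) ∂P
      = ∫ ω, Ψ (Y ω, (B.D n ω, B.X n ω)) ∂P := by
        rw [← integral_indicator (B.measurableSet_pending hA t n)]
        refine integral_congr_ae (Eventually.of_forall fun ω => ?_)
        by_cases h : ω ∈ B.pending A t n <;> simp [hΨ, hY, h]
    _ = ∫ q, Ψ q ∂((P.map Y).prod ((expMeasure lam).prod ν)) := by
        rw [← hlaw, integral_map hYZ.aemeasurable hΨm.aestronglyMeasurable]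
    _ = ∫ y, y.2 * w y.1 ∂(P.map Y) := by
        rw [integral_prod _ hint]
        refine integral_congr_ae (Eventually.of_forall fun y => ?_)
        simp only [hΨ, integral_const_mul, hw]
    _ = ∫ ω in B.pending A t n, w (B.remaining t n ω) ∂P := by
        have hm : Measurable fun y : ℝ × ℝ => y.2 * w y.1 :=
          measurable_snd.mul (hwm.measurable.comp measurable_fst)
        rw [integral_map hYm.aemeasurable hm.aestronglyMeasurable,
          ← integral_indicator (B.measurableSet_pending hA t n)]
        refine integral_congr_ae (Eventually.of_forall fun ω => ?_)
        by_cases h : ω ∈ B.pending A t n <;> simp [hY, h]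

lemma ae_D_nonneg : ∀ᵐ ω ∂P, ∀ n, 0 ≤ B.D n ω := by
  rw [ae_all_iff]
  intro n
  have h : ∀ᵐ d ∂(expMeasure lam), 0 ≤ d := by
    have : {d : ℝ | ¬ 0 ≤ d} = Set.Iio 0 := by ext; simp
    rw [ae_iff, this, expMeasure, gammaMeasure, withDensity_apply _ measurableSet_Iio]
    exact lintegral_gammaPDF_of_nonpos le_rfl
  rw [← (B.law_D n).map_eq] at h
  exact ae_of_ae_map (B.measurable_D n).aemeasurable h

lemma measure_D_gt [IsProbabilityMeasure P] (hlam : 0 < lam) {s : ℝ} (hs : 0 ≤ s) (n : ℕ) :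
    P (B.D n ⁻¹' Set.Ioi s) = ENNReal.ofReal (Real.exp (-(lam * s))) := by
  have := isProbabilityMeasure_expMeasure hlam
  have h1 : (expMeasure lam).real (Set.Iic s) = 1 - Real.exp (-(lam * s)) := by
    rw [← cdf_eq_real, cdf_expMeasure_eq hlam, if_pos hs]
  rw [← Measure.map_apply (B.measurable_D n) measurableSet_Ioi, (B.law_D n).map_eq,
    ← Set.compl_Iic, prob_compl_eq_one_sub measurableSet_Iic, ← ofReal_measureReal, h1,
    ← ENNReal.ofReal_one, ← ENNReal.ofReal_sub _ (by
      rw [sub_nonneg]; exact Real.exp_le_one_iff.2 (by nlinarith))]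
  congr 1
  ring

/-- Almost surely one of the durations exceeds `s`. -/
lemma ae_exists_D_gt [IsProbabilityMeasure P] (hlam : 0 < lam) {s : ℝ} (hs : 0 ≤ s) :
    ∀ᵐ ω ∂P, ∃ n, s < B.D n ω := by
  have hm : ∀ n, MeasurableSet (B.D n ⁻¹' Set.Ioi s) := fun n =>
    B.measurable_D n measurableSet_Ioi
  have hD : iIndepFun B.D P := B.indep_pairs.comp (fun _ => Prod.fst) fun _ => measurable_fst
  have hi : iIndepSet (fun n => B.D n ⁻¹' Set.Ioi s) P := by
    rw [iIndepSet_iff_meas_biInter hm]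
    exact fun S => hD.measure_inter_preimage_eq_mul S (fun _ _ => measurableSet_Ioi)
  have h1 := measure_limsup_eq_one hm hi (by
    simp only [B.measure_D_gt hlam hs]
    exact ENNReal.tsum_const_eq_top_of_ne_zero (by simp [Real.exp_pos]))
  have h2 : ∀ᵐ ω ∂P, ω ∈ limsup (fun n => B.D n ⁻¹' Set.Ioi s) atTop := by
    rw [← prob_compl_eq_zero_iff (MeasurableSet.measurableSet_limsup hm)] at h1
    exact h1
  filter_upwards [h2] with ω hω
  rw [mem_limsup_iff_frequently_mem] at hω
  exact hω.exists

lemma remaining_succ (t : ℝ) (n : ℕ) (ω : Ω) :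
    B.remaining t (n + 1) ω = max (B.remaining t n ω - B.D n ω) 0 := rfl

/-- Almost surely the deadline is reached after finitely many offers. -/
lemma ae_eventually_remaining_eq_zero [IsProbabilityMeasure P] (hlam : 0 < lam) (t : ℝ) :
    ∀ᵐ ω ∂P, ∃ N, ∀ n ≥ N, B.remaining t n ω = 0 := by
  filter_upwards [B.ae_D_nonneg, B.ae_exists_D_gt hlam (le_max_right t 0)] with ω hD ⟨N, hN⟩
  have hle : ∀ n, B.remaining t n ω ≤ max t 0 := by
    intro n
    induction n with
    | zero => exact le_max_left _ _
    | succ n ih =>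
      rw [remaining_succ]
      exact max_le (by linarith [hD n]) (le_max_right _ _)
  refine ⟨N + 1, fun n hn => ?_⟩
  induction n, hn using Nat.le_induction with
  | base => rw [remaining_succ]; exact max_eq_right (by linarith [hle N])
  | succ n _ ih => rw [remaining_succ, ih]; exact max_eq_right (by linarith [hD n])

lemma salePrice_of_forall_not {ω : Ω} (h : ∀ n, ¬ B.Accepts A t ω n) :
    B.salePrice A t ω = B.X₀ ω := by
  rw [salePrice, dif_neg (by simpa using h)]

lemma salePrice_of_pending {ω : Ω} {n : ℕ} (h : ω ∈ B.pending A t n) (ha : B.Accepts A t ω n) :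
    B.salePrice A t ω = B.X n ω := by
  classical
  have hex : ∃ n, B.Accepts A t ω n := ⟨n, ha⟩
  rw [salePrice, dif_pos hex]
  congr 1
  rw [Nat.find_eq_iff]
  exact ⟨ha, h⟩

lemma exists_pending_of_accepts {ω : Ω} (h : ∃ n, B.Accepts A t ω n) :
    ∃ n, ω ∈ B.pending A t n ∧ B.Accepts A t ω n := by
  classical
  exact ⟨Nat.find h, fun k hk => Nat.find_min h hk, Nat.find_spec h⟩

lemma pending_succ (n : ℕ) (ω : Ω) :
    ω ∈ B.pending A t (n + 1) ↔ ω ∈ B.pending A t n ∧ ¬ B.Accepts A t ω n := by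
  simp only [pending, Set.mem_ofPred_eq, Nat.lt_succ_iff_lt_or_eq]
  constructor
  · exact fun h => ⟨fun k hk => h k (Or.inl hk), h n (Or.inr rfl)⟩
  · rintro ⟨h1, h2⟩ k (hk | rfl)
    exacts [h1 k hk, h2]

lemma measurable_salePrice (hA : MeasurableSet A) (t : ℝ) : Measurable (B.salePrice A t) := by
  classical
  -- on the event that the first accepted offer has index `n`, the price is `X n`
  intro U hU
  have : B.salePrice A t ⁻¹' U =
      (⋃ n, (B.pending A t n ∩ {ω | B.Accepts A t ω n}) ∩ B.X n ⁻¹' U) ∪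
        ((⋂ n, {ω | B.Accepts A t ω n}ᶜ) ∩ B.X₀ ⁻¹' U) := by
    ext ω
    simp only [Set.mem_preimage, Set.mem_union, Set.mem_iUnion, Set.mem_inter_iff,
      Set.mem_iInter, Set.mem_compl_iff, Set.mem_ofPred_eq]
    constructor
    · intro h
      by_cases hex : ∃ n, B.Accepts A t ω n
      · obtain ⟨n, h1, h2⟩ := B.exists_pending_of_accepts hex
        exact Or.inl ⟨n, ⟨h1, h2⟩, by rwa [← B.salePrice_of_pending h1 h2]⟩
      · push Not at hex
        exact Or.inr ⟨hex, by rwa [← B.salePrice_of_forall_not hex]⟩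
    · rintro (⟨n, ⟨h1, h2⟩, h3⟩ | ⟨h1, h2⟩)
      · rwa [B.salePrice_of_pending h1 h2]
      · rwa [B.salePrice_of_forall_not h1]
  rw [this]
  refine MeasurableSet.union (MeasurableSet.iUnion fun n => ?_) ?_
  · exact ((B.measurableSet_pending hA t n).inter (B.measurableSet_accepts hA t n)).inter
      (B.measurable_X n hU)
  · exact (MeasurableSet.iInter fun n => (B.measurableSet_accepts hA t n).compl).inter
      (B.measurable_X₀ hU)

/-- The information carried by the whole sequence of offers and durations. -/
@[reducible] def history : MeasurableSpace Ω :=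
  MeasurableSpace.comap (fun ω n => (B.D n ω, B.X n ω)) inferInstance

lemma past_le_history (n : ℕ) : B.past n ≤ B.history := by
  refine iSup₂_le fun k _ => ?_
  have hc : Measurable[B.history] fun ω => (B.D k ω, B.X k ω) :=
    (measurable_pi_apply k).comp (comap_measurable fun ω n => (B.D n ω, B.X n ω))
  exact hc.comap_le

/-- The event that no offer is ever accepted is independent of the residual price. -/
lemma indepFun_indicator_never (hA : MeasurableSet A) (t : ℝ) :
    IndepFun ((⋂ n, B.pending A t n).indicator (fun _ => (1 : ℝ))) B.X₀ P := by
  have hs : MeasurableSet[B.history] (⋂ n, B.pending A t n) :=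
    MeasurableSet.iInter fun n => B.past_le_history n _ (B.measurableSet_pending_past hA t n)
  have hf : Measurable[B.history] ((⋂ n, B.pending A t n).indicator (fun _ => (1 : ℝ))) :=
    measurable_const.indicator hs
  exact indep_of_indep_of_le_left (Indep.symm B.indep_X₀) hf.comap_le

/-- Verification: if `w` is the mean of `Φ`, which dominates the payoff `f x` of accepting the next
offer under the policy `A`, or the value `w` of the remaining time after rejecting it, then the
policy `A` earns at most `w t` on average. The mean of the process equal to `f` of the sale price
once the asset is sold, and to `w` of the remaining time before, is nonincreasing. -/
theorem integral_comp_salePrice_le [IsProbabilityMeasure P] (hlam : 0 < lam)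
    [IsProbabilityMeasure ν] (hA : MeasurableSet A) {f : ℝ → ℝ} (hf : Measurable f)
    (hint : Integrable (fun ω => f (B.salePrice A t ω)) P)
    (hint₀ : Integrable (fun ω => f (B.X₀ ω)) P)
    {w : ℝ → ℝ} {K : ℝ} (hwK : ∀ s, |w s| ≤ K) (hw0 : w 0 = ∫ ω, f (B.X₀ ω) ∂P)
    {Φ : ℝ → ℝ × ℝ → ℝ} (hΦ : Measurable fun q : ℝ × ℝ × ℝ => Φ q.1 q.2) {C : ℝ}
    (hΦC : ∀ s z, |Φ s z| ≤ C)
    (hw : ∀ s, ∫ z, Φ s z ∂((expMeasure lam).prod ν) = w s)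
    {E : Set ℝ} (hE : ∀ᵐ x ∂ν, x ∈ E)
    (hacc : ∀ s d x, x ∈ E → 0 < max (s - d) 0 → (max (s - d) 0, x) ∈ A → f x ≤ Φ s (d, x))
    (hrej : ∀ s d x, x ∈ E → ¬ (0 < max (s - d) 0 ∧ (max (s - d) 0, x) ∈ A) →
      w (max (s - d) 0) ≤ Φ s (d, x)) :
    ∫ ω, f (B.salePrice A t ω) ∂P ≤ w t := by
  classical
  have := isProbabilityMeasure_expMeasure hlam
  have hwm : Measurable w := by
    have : w = fun s => ∫ z, Φ s z ∂((expMeasure lam).prod ν) := by ext s; rw [hw]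
    rw [this]
    exact hΦ.stronglyMeasurable.integral_prod_right.measurable
  have hSm : Measurable fun ω => f (B.salePrice A t ω) := hf.comp (B.measurable_salePrice hA t)
  have hXE : ∀ᵐ ω ∂P, ∀ n, B.X n ω ∈ E := by
    rw [ae_all_iff]
    intro n
    rw [← (B.law_X n).map_eq] at hE
    exact ae_of_ae_map (B.measurable_X n).aemeasurable hE
  set V : ℕ → Ω → ℝ := fun n ω =>
    if ω ∈ B.pending A t n then w (B.remaining t n ω) else f (B.salePrice A t ω) with hV
  have hVm : ∀ n, Measurable (V n) := fun n =>
    Measurable.ite (B.measurableSet_pending hA t n) (hwm.comp (B.measurable_remaining t n)) hSm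
  have hVb : ∀ n ω, ‖V n ω‖ ≤ K + ‖f (B.salePrice A t ω)‖ := by
    intro n ω
    have hK0 : 0 ≤ K := (abs_nonneg _).trans (hwK 0)
    simp only [hV]
    split_ifs
    · exact (hwK _).trans (le_add_of_nonneg_right (norm_nonneg _))
    · exact le_add_of_nonneg_left hK0
  have hbi : Integrable (fun ω => K + ‖f (B.salePrice A t ω)‖) P :=
    (integrable_const K).add hint.norm
  have hVi : ∀ n, Integrable (V n) P := fun n =>
    hbi.mono' (hVm n).aestronglyMeasurable (Eventually.of_forall (hVb n))
  have hstep : ∀ n, ∫ ω, V (n + 1) ω ∂P ≤ ∫ ω, V n ω ∂P := by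
    intro n
    have hpm := B.measurableSet_pending hA t n
    have hi1 : Integrable ((B.pending A t n).indicator
        fun ω => Φ (B.remaining t n ω) (B.D n ω, B.X n ω)) P := by
      refine Integrable.indicator (Integrable.of_bound (C := C) ?_ ?_) hpm
      · exact (hΦ.comp ((B.measurable_remaining t n).prodMk
          (B.measurable_pair n))).aestronglyMeasurable
      · exact Eventually.of_forall fun ω => hΦC _ _
    have hi2 : Integrable ((B.pending A t n).indicator fun ω => w (B.remaining t n ω)) P := by
      refine Integrable.indicator (Integrable.of_bound (C := K) ?_ ?_) hpm
      · exact (hwm.comp (B.measurable_remaining t n)).aestronglyMeasurable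
      · exact Eventually.of_forall fun ω => hwK _
    have hle : ∀ᵐ ω ∂P, V (n + 1) ω ≤ V n ω + ((B.pending A t n).indicator
        (fun ω => Φ (B.remaining t n ω) (B.D n ω, B.X n ω)) ω -
        (B.pending A t n).indicator (fun ω => w (B.remaining t n ω)) ω) := by
      filter_upwards [hXE] with ω hω
      simp only [hV, B.pending_succ]
      by_cases hp : ω ∈ B.pending A t n
      · by_cases ha : B.Accepts A t ω n
        · have := hacc (B.remaining t n ω) (B.D n ω) (B.X n ω) (hω n) ha.1 ha.2
          simp only [hp, ha, not_true_eq_false, and_false, if_false, if_true,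
            Set.indicator_of_mem, B.salePrice_of_pending hp ha]
          linarith
        · have := hrej (B.remaining t n ω) (B.D n ω) (B.X n ω) (hω n) ha
          simp only [hp, ha, not_false_eq_true, and_self, if_true, Set.indicator_of_mem,
            remaining_succ]
          linarith
      · simp [hp]
    have hi : Integrable (fun ω => (B.pending A t n).indicator
        (fun ω => Φ (B.remaining t n ω) (B.D n ω, B.X n ω)) ω -
        (B.pending A t n).indicator (fun ω => w (B.remaining t n ω)) ω) P := hi1.sub hi2
    calc ∫ ω, V (n + 1) ω ∂P ≤ ∫ ω, (V n ω + ((B.pending A t n).indicator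
        (fun ω => Φ (B.remaining t n ω) (B.D n ω, B.X n ω)) ω -
        (B.pending A t n).indicator (fun ω => w (B.remaining t n ω)) ω)) ∂P :=
          integral_mono_ae (hVi _) ((hVi n).add hi) hle
      _ = ∫ ω, V n ω ∂P := by
          rw [integral_add (hVi n) hi, integral_sub hi1 hi2, integral_indicator hpm,
            integral_indicator hpm, B.setIntegral_pending_step hA t n hΦ hΦC hw, sub_self, add_zero]
  have hVle : ∀ n, ∫ ω, V n ω ∂P ≤ w t := by
    intro n
    induction n with
    | zero => simp [hV, pending, remaining]
    | succ n ih => exact (hstep n).trans ih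
  set N : Set Ω := ⋂ n, B.pending A t n with hN
  have hNm : MeasurableSet N := MeasurableSet.iInter fun n => B.measurableSet_pending hA t n
  have hlim : ∀ᵐ ω ∂P, Tendsto (fun n => V n ω) atTop
      (𝓝 (if ω ∈ N then w 0 else f (B.salePrice A t ω))) := by
    filter_upwards [B.ae_eventually_remaining_eq_zero hlam t] with ω ⟨k, hk⟩
    by_cases h : ω ∈ N
    · rw [if_pos h]
      refine tendsto_const_nhds.congr' ?_
      filter_upwards [eventually_ge_atTop k] with n hn
      simp only [hV]
      rw [if_pos (Set.mem_iInter.1 h n), hk n hn]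
    · rw [if_neg h]
      obtain ⟨m, hm⟩ : ∃ m, ω ∉ B.pending A t m := by simpa [hN] using h
      refine tendsto_const_nhds.congr' ?_
      filter_upwards [eventually_ge_atTop m] with n hn
      simp only [hV]
      rw [if_neg fun h' => hm fun i hi => h' i (hi.trans_le hn)]
  have hle : ∫ ω, (if ω ∈ N then w 0 else f (B.salePrice A t ω)) ∂P ≤ w t :=
    le_of_tendsto (tendsto_integral_of_dominated_convergence _
      (fun n => (hVm n).aestronglyMeasurable) hbi
      (fun n => Eventually.of_forall (hVb n)) hlim) (Eventually.of_forall hVle)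
  have hind : ∫ ω, N.indicator (fun _ => (1 : ℝ)) ω * f (B.X₀ ω) ∂P =
      (∫ ω, N.indicator (fun _ => (1 : ℝ)) ω ∂P) * ∫ ω, f (B.X₀ ω) ∂P :=
    ((B.indepFun_indicator_never hA t).comp measurable_id hf).integral_fun_mul_eq_mul_integral
      (measurable_const.indicator hNm).aestronglyMeasurable hint₀.aestronglyMeasurable
  have hNi : Integrable (N.indicator fun _ => (1 : ℝ)) P := (integrable_const _).indicator hNm
  have hNfi : Integrable (fun ω => N.indicator (fun _ => (1 : ℝ)) ω * f (B.X₀ ω)) P := by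
    refine (hint₀.indicator hNm).congr (Eventually.of_forall fun ω => ?_)
    by_cases h : ω ∈ N <;> simp [h]
  have hWi : Integrable (fun ω => if ω ∈ N then w 0 else f (B.salePrice A t ω)) P := by
    refine hbi.mono' (Measurable.ite hNm measurable_const hSm).aestronglyMeasurable
      (Eventually.of_forall fun ω => ?_)
    have hK0 : 0 ≤ K := (abs_nonneg _).trans (hwK 0)
    split_ifs
    · exact (hwK _).trans (le_add_of_nonneg_right (norm_nonneg _))
    · exact le_add_of_nonneg_left hK0
  have heq : ∫ ω, f (B.salePrice A t ω) ∂P =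
      ∫ ω, ((if ω ∈ N then w 0 else f (B.salePrice A t ω)) +
        (N.indicator (fun _ => (1 : ℝ)) ω * f (B.X₀ ω) -
          N.indicator (fun _ => (1 : ℝ)) ω * w 0)) ∂P := by
    refine integral_congr_ae (Eventually.of_forall fun ω => ?_)
    by_cases h : ω ∈ N
    · have h' : ∀ n, ¬ B.Accepts A t ω n := fun n =>
        Set.mem_iInter.1 h (n + 1) n n.lt_succ_self
      simp [h, B.salePrice_of_forall_not h']
    · simp [h]
  have hNd : Integrable (fun ω => N.indicator (fun _ => (1 : ℝ)) ω * f (B.X₀ ω) -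
      N.indicator (fun _ => (1 : ℝ)) ω * w 0) P := hNfi.sub (hNi.mul_const _)
  rw [integral_add hWi hNd, integral_sub hNfi (hNi.mul_const _), hind,
    integral_mul_const, hw0, sub_self, add_zero, ← hw0] at heq
  exact heq.trans_le hle

end BiddingProcess

/-! ### Moments of the excess over a level -/

/-- The mean excess `E[(X - x)_+]` of a random variable `X` of law `ν` over the level `x`. -/
def meanExcess (ν : Measure ℝ) (x : ℝ) : ℝ := ∫ y, max (y - x) 0 ∂ν

/-- The second moment `E[(X - x)_+ ^ 2]` of the excess of a random variable `X` of law `ν` over the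
level `x`. -/
def sqExcess (ν : Measure ℝ) (x : ℝ) : ℝ := ∫ y, max (y - x) 0 ^ 2 ∂ν

section Excess

variable {ν : Measure ℝ} [IsProbabilityMeasure ν] {M : ℝ}

lemma integrable_excess (hM : ∀ᵐ y ∂ν, y ≤ M) (x : ℝ) : Integrable (fun y => max (y - x) 0) ν := by
  refine Integrable.of_bound (C := max (M - x) 0) (by fun_prop) ?_
  filter_upwards [hM] with y hy
  rw [Real.norm_of_nonneg (le_max_right _ _)]
  gcongr

lemma integrable_excess_sq (hM : ∀ᵐ y ∂ν, y ≤ M) (x : ℝ) :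
    Integrable (fun y => max (y - x) 0 ^ 2) ν := by
  refine Integrable.of_bound (C := max (M - x) 0 ^ 2) (by fun_prop) ?_
  filter_upwards [hM] with y hy
  rw [Real.norm_of_nonneg (sq_nonneg _)]
  gcongr

lemma tailIntegral_eq_meanExcess (hM : ∀ᵐ y ∂ν, y ≤ M) (x : ℝ) :
    tailIntegral ν x = meanExcess ν x := by
  rw [meanExcess, (integrable_excess hM x).integral_eq_integral_meas_lt
    (Eventually.of_forall fun y => le_max_right _ _)]
  have h1 : ∫ u in Set.Ioi (0 : ℝ), ν.real {y | u < max (y - x) 0} =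
      ∫ u in Set.Ioi (0 : ℝ), (1 - cdf ν (u + x)) := by
    refine setIntegral_congr_fun measurableSet_Ioi fun u hu => ?_
    have : {y : ℝ | u < max (y - x) 0} = (Set.Iic (u + x))ᶜ := by
      ext y
      simp only [Set.mem_ofPred_eq, lt_max_iff, Set.mem_compl_iff, Set.mem_Iic, not_le]
      have hu' : 0 < u := hu
      constructor
      · rintro (h | h) <;> linarith
      · intro h; left; linarith
    simp only [this]
    rw [probReal_compl_eq_one_sub measurableSet_Iic, cdf_eq_real]
  rw [h1, tailIntegral]
  have h2 := (measurePreserving_add_right volume x).setIntegral_preimage_emb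
    (measurableEmbedding_addRight x) (fun u => 1 - cdf ν u) (Set.Ioi x)
  simpa using h2.symm

lemma meanExcess_nonneg (ν : Measure ℝ) (x : ℝ) : 0 ≤ meanExcess ν x :=
  integral_nonneg fun _ => le_max_right _ _

lemma meanExcess_pos (hM : ∀ᵐ y ∂ν, y ≤ M) {x : ℝ} (hx : ν (Set.Ioi x) ≠ 0) :
    0 < meanExcess ν x := by
  rw [meanExcess, integral_pos_iff_support_of_nonneg (fun y => le_max_right (y - x) (0 : ℝ))
    (integrable_excess hM x)]
  refine (pos_iff_ne_zero.2 hx).trans_le (measure_mono fun y hy => ?_)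
  have : 0 < y - x := sub_pos.2 hy
  simp [this.ne', max_eq_left this.le]

lemma meanExcess_le (hM : ∀ᵐ y ∂ν, y ≤ M) {x : ℝ} (hx : x ≤ M) : meanExcess ν x ≤ M - x := by
  have h : ∫ y, max (y - x) 0 ∂ν ≤ ∫ _, (M - x) ∂ν := by
    refine integral_mono_ae (integrable_excess hM x) (integrable_const _) ?_
    filter_upwards [hM] with y hy
    exact max_le (by linarith) (by linarith)
  simpa [meanExcess] using h

lemma meanExcess_antitone (hM : ∀ᵐ y ∂ν, y ≤ M) : Antitone (meanExcess ν) := fun x x' h =>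
  integral_mono (integrable_excess hM x') (integrable_excess hM x) fun y => by
    dsimp only; gcongr

lemma lipschitzWith_max_sub (y : ℝ) : LipschitzWith 1 fun x : ℝ => max (y - x) 0 :=
  LipschitzWith.of_dist_le_mul fun a b => by
    simp only [Real.dist_eq, NNReal.coe_one, one_mul]
    calc |max (y - a) 0 - max (y - b) 0| ≤ |(y - a) - (y - b)| := abs_max_sub_max_le_abs _ _ _
      _ = |a - b| := by rw [abs_sub_comm a b]; congr 1; ring

lemma continuous_meanExcess (hM : ∀ᵐ y ∂ν, y ≤ M) : Continuous (meanExcess ν) := by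
  refine LipschitzWith.continuous (K := 1) (LipschitzWith.of_dist_le_mul fun a b => ?_)
  rw [dist_eq_norm, meanExcess, meanExcess,
    ← integral_sub (integrable_excess hM a) (integrable_excess hM b)]
  refine (norm_integral_le_of_norm_le_const (C := dist a b) (Eventually.of_forall fun y => ?_)).trans
    (by simp)
  have := (lipschitzWith_max_sub y).dist_le_mul a b
  simpa [dist_eq_norm] using this

/-- Away from the atoms of `ν`, the mean excess is differentiable. -/
lemma hasDerivAt_meanExcess (hM : ∀ᵐ y ∂ν, y ≤ M) {x : ℝ} (hx : ν {x} = 0) :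
    HasDerivAt (meanExcess ν) (-ν.real (Set.Ioi x)) x := by
  have h := (hasDerivAt_integral_of_dominated_loc_of_lip (μ := ν) (x₀ := x) (s := Set.univ)
    (F := fun x y => max (y - x) 0) (F' := (Set.Ioi x).indicator fun _ => -1)
    (bound := fun _ => 1) univ_mem (Eventually.of_forall fun x => by fun_prop)
    (integrable_excess hM x)
    (measurable_const.indicator measurableSet_Ioi).aestronglyMeasurable
    (Eventually.of_forall fun y => by
      simpa using lipschitzWith_max_sub y) (integrable_const _) ?_).2
  · rw [integral_indicator measurableSet_Ioi] at h
    simp only [integral_const, measureReal_restrict_apply_univ, smul_eq_mul, mul_neg, mul_one] at h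
    exact h
  · have hne : ∀ᵐ y ∂ν, y ≠ x := by rw [ae_iff]; simpa using hx
    filter_upwards [hne] with y hy
    rcases lt_or_gt_of_ne hy with h | h
    · rw [Set.indicator_of_notMem (by simpa using h.le)]
      refine (hasDerivAt_const x (0 : ℝ)).congr_of_eventuallyEq ?_
      filter_upwards [eventually_gt_nhds h] with z hz
      exact max_eq_right (by linarith)
    · rw [Set.indicator_of_mem (by simpa using h)]
      refine ((hasDerivAt_id x).const_sub y).congr_of_eventuallyEq ?_
      filter_upwards [eventually_lt_nhds h] with z hz
      exact max_eq_left (sub_nonneg.2 hz.le)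

lemma countable_atoms (ν : Measure ℝ) [IsProbabilityMeasure ν] : {x | ν {x} ≠ 0}.Countable := by
  have := Measure.countable_meas_pos_of_disjoint_iUnion (μ := ν) (As := fun x : ℝ => {x})
    (fun x => measurableSet_singleton x) (fun x y h => by simpa using h)
  simpa [pos_iff_ne_zero] using this

lemma hasDerivAt_max_zero_sq (u : ℝ) :
    HasDerivAt (fun u : ℝ => max u 0 ^ 2) (2 * max u 0) u := by
  rcases lt_trichotomy u 0 with h | rfl | h
  · rw [max_eq_right h.le, mul_zero]
    refine (hasDerivAt_const u (0 : ℝ)).congr_of_eventuallyEq ?_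
    filter_upwards [eventually_lt_nhds h] with z hz
    simp [max_eq_right hz.le]
  · rw [max_self, mul_zero, hasDerivAt_iff_isLittleO_nhds_zero]
    simp only [zero_add, max_self, smul_zero, sub_zero, ne_eq, OfNat.ofNat_ne_zero,
      not_false_eq_true, zero_pow]
    refine IsBigO.trans_isLittleO (g := fun h : ℝ => h ^ 2) (IsBigO.of_bound 1 ?_)
      (isLittleO_pow_id one_lt_two)
    refine Eventually.of_forall fun z => ?_
    rw [one_mul, Real.norm_of_nonneg (sq_nonneg _), Real.norm_of_nonneg (sq_nonneg _)]
    rcases le_total z 0 with hz | hz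
    · simp [max_eq_right hz, sq_nonneg]
    · simp [max_eq_left hz]
  · rw [max_eq_left h.le]
    have h2 : HasDerivAt (fun u : ℝ => u ^ 2) (2 * u) u := by simpa using hasDerivAt_pow 2 u
    refine h2.congr_of_eventuallyEq ?_
    filter_upwards [eventually_gt_nhds h] with z hz
    simp [max_eq_left hz.le]

lemma hasDerivAt_sqExcess (hM : ∀ᵐ y ∂ν, y ≤ M) (x : ℝ) :
    HasDerivAt (sqExcess ν) (-(2 * meanExcess ν x)) x := by
  have h := (hasDerivAt_integral_of_dominated_loc_of_deriv_le (μ := ν) (x₀ := x)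
    (s := Set.Ioi (x - 1)) (F := fun x y => max (y - x) 0 ^ 2)
    (F' := fun x y => -(2 * max (y - x) 0))
    (bound := fun _ => 2 * max (M - (x - 1)) 0) (Ioi_mem_nhds (by linarith))
    (Eventually.of_forall fun x => by fun_prop) (integrable_excess_sq hM x) (by fun_prop) ?_
    (integrable_const _) ?_).2
  · rw [integral_neg, integral_const_mul] at h
    exact h
  · filter_upwards [hM] with y hy z hz
    have hz' : x - 1 < z := hz
    rw [norm_neg, Real.norm_of_nonneg (by positivity)]
    gcongr
  · refine Eventually.of_forall fun y z _ => ?_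
    have := (hasDerivAt_max_zero_sq (y - z)).comp z ((hasDerivAt_id z).const_sub y)
    simpa [Function.comp_def] using this

lemma continuous_sqExcess (hM : ∀ᵐ y ∂ν, y ≤ M) : Continuous (sqExcess ν) :=
  continuous_iff_continuousAt.2 fun x => (hasDerivAt_sqExcess hM x).continuousAt

lemma sqExcess_nonneg (ν : Measure ℝ) (x : ℝ) : 0 ≤ sqExcess ν x :=
  integral_nonneg fun _ => sq_nonneg _

lemma sqExcess_le (hM : ∀ᵐ y ∂ν, y ≤ M) {x : ℝ} (hx : x ≤ M) :
    sqExcess ν x ≤ (M - x) * meanExcess ν x := by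
  rw [meanExcess, ← integral_const_mul]
  refine integral_mono_ae (integrable_excess_sq hM x) ((integrable_excess hM x).const_mul _) ?_
  filter_upwards [hM] with y hy
  rw [sq]
  exact mul_le_mul_of_nonneg_right (max_le (by linarith) (by linarith)) (le_max_right _ _)

lemma variance_excess (hM : ∀ᵐ y ∂ν, y ≤ M) (x : ℝ) :
    variance (fun y => max (y - x) 0) ν = sqExcess ν x - meanExcess ν x ^ 2 := by
  rw [variance_eq_sub]
  · rfl
  · rw [memLp_two_iff_integrable_sq (by fun_prop)]
    exact integrable_excess_sq hM x

end Excess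

lemma sqExcess_eq_zero {ν : Measure ℝ} {M : ℝ} (hM : ∀ᵐ y ∂ν, y ≤ M) : sqExcess ν M = 0 := by
  refine integral_eq_zero_of_ae ?_
  filter_upwards [hM] with y hy
  simp [max_eq_right (sub_nonpos.2 hy)]

/-! ### Differential equations -/

/-- The variation of constants formula, read as an expectation: if `w' = λ (h - w)`, then `w s` is
the mean of `h (s - d)` for an exponential time `d` of rate `λ`, replaced by `w 0` if
`d ≥ s`. The equation may fail at countably many times. -/
lemma integral_expMeasure_of_hasDerivAt {lam : ℝ} (hlam : 0 < lam) {w h : ℝ → ℝ}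
    (hw : Continuous w) (hh : Measurable h) {C : ℝ} (hC : ∀ r, |h r| ≤ C) {S : Set ℝ}
    (hS : S.Countable)
    (hd : ∀ r, 0 < r → r ∉ S → HasDerivAt w (lam * (h r - w r)) r) (s : ℝ) :
    ∫ d, (if 0 < max (s - d) 0 then h (max (s - d) 0) else w 0) ∂(expMeasure lam) =
      w (max s 0) := by
  have hpdf : ∀ F : ℝ → ℝ, ∫ d, F d ∂(expMeasure lam) =
      ∫ d in Set.Ioi 0, lam * Real.exp (-(lam * d)) * F d := by
    intro F
    have hm : Measurable (gammaPDF 1 lam) := (measurable_gammaPDFReal 1 lam).ennreal_ofReal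
    rw [expMeasure, gammaMeasure, integral_withDensity_eq_integral_toReal_smul hm
      (Eventually.of_forall fun _ => ENNReal.ofReal_lt_top), ← integral_Ici_eq_integral_Ioi,
      ← integral_indicator measurableSet_Ici]
    congr 1
    ext d
    change (exponentialPDF lam d).toReal • F d = _
    rw [exponentialPDF_eq]
    by_cases hd0 : 0 ≤ d
    · rw [if_pos hd0, Set.indicator_of_mem (by simpa using hd0),
        ENNReal.toReal_ofReal (by positivity), smul_eq_mul]
    · rw [if_neg hd0, Set.indicator_of_notMem (by simpa using hd0)]
      simp
  have hprob := isProbabilityMeasure_expMeasure hlam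
  rcases le_or_gt s 0 with hs | hs
  · rw [hpdf, max_eq_right hs]
    have h1 : ∀ d ∈ Set.Ioi (0 : ℝ), lam * Real.exp (-(lam * d)) *
        (if 0 < max (s - d) 0 then h (max (s - d) 0) else w 0) =
        lam * Real.exp (-(lam * d)) * w 0 := by
      intro d hd
      have hd' : 0 < d := hd
      rw [if_neg (by simp; linarith)]
    rw [setIntegral_congr_fun measurableSet_Ioi h1, ← hpdf]
    simp
  · rw [max_eq_left hs.le]
    have h1 : ∀ d, (if 0 < max (s - d) 0 then h (max (s - d) 0) else w 0) =
        w 0 + (Set.Iio s).indicator (fun d => h (s - d) - w 0) d := by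
      intro d
      by_cases hd : d < s
      · have : 0 < s - d := by linarith
        simp [hd, max_eq_left this.le]
      · simp [hd]
    have hm : Measurable ((Set.Iio s).indicator fun d => h (s - d) - w 0) :=
      ((hh.comp (measurable_const.sub measurable_id)).sub_const _).indicator measurableSet_Iio
    have hi : Integrable ((Set.Iio s).indicator fun d => h (s - d) - w 0) (expMeasure lam) := by
      refine Integrable.of_bound hm.aestronglyMeasurable (C + |w 0|) (Eventually.of_forall fun d => ?_)
      refine (norm_indicator_le_norm_self _ _).trans ((norm_sub_le _ _).trans ?_)
      simpa using hC (s - d)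
    simp only [h1]
    rw [integral_add (integrable_const _) hi, integral_const, probReal_univ, one_smul, hpdf]
    have h2 : ∫ d in Set.Ioi 0, lam * Real.exp (-(lam * d)) *
        (Set.Iio s).indicator (fun d => h (s - d) - w 0) d =
        ∫ d in (0 : ℝ)..s, lam * Real.exp (-(lam * d)) * (h (s - d) - w 0) := by
      rw [intervalIntegral.integral_of_le hs.le, integral_Ioc_eq_integral_Ioo,
        ← Set.Ioi_inter_Iio, ← setIntegral_indicator measurableSet_Iio]
      congr 1
      ext d
      by_cases hd : d < s <;> simp [hd]
    have h3 : ∫ d in (0 : ℝ)..s, lam * Real.exp (-(lam * d)) * (h (s - d) - w 0) =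
        ∫ r in (0 : ℝ)..s, lam * Real.exp (-(lam * (s - r))) * (h r - w 0) := by
      have := intervalIntegral.integral_comp_sub_left (a := 0) (b := s)
        (fun r => lam * Real.exp (-(lam * (s - r))) * (h r - w 0)) s
      simpa using this
    have h4 : ∫ r in (0 : ℝ)..s, lam * Real.exp (-(lam * (s - r))) * (h r - w 0) =
        Real.exp (-(lam * (s - s))) * (w s - w 0) - Real.exp (-(lam * (s - 0))) * (w 0 - w 0) := by
      refine integral_eq_of_hasDerivAt_off_countable
        (fun r => Real.exp (-(lam * (s - r))) * (w r - w 0)) _ hS (by fun_prop) ?_ ?_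
      · rintro r ⟨hr, hrS⟩
        rw [min_eq_left hs.le] at hr
        have e1 : HasDerivAt (fun r => -(lam * (s - r))) lam r := by
          have := (((hasDerivAt_id r).const_sub s).const_mul lam).fun_neg
          simpa using this
        have e2 := e1.exp.mul ((hd r hr.1 hrS).sub_const (w 0))
        convert! e2 using 1
        ring
      · refine IntervalIntegrable.continuousOn_mul ?_ (by fun_prop)
        refine IntervalIntegrable.sub ?_ intervalIntegrable_const
        rw [intervalIntegrable_iff_integrableOn_Ioc_of_le hs.le]
        exact Integrable.of_bound hh.aestronglyMeasurable C (Eventually.of_forall hC)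
    rw [h2, h3, h4]
    simp

lemma hasDerivAt_integral_of_continuousOn_Iio {F : ℝ → ℝ} {a M w : ℝ}
    (hF : ContinuousOn F (Set.Iio M)) (ha : a < M) (hw : w < M) :
    HasDerivAt (fun w => ∫ u in a..w, F u) (F w) w := by
  refine intervalIntegral.integral_hasDerivAt_right ?_
    (hF.stronglyMeasurableAtFilter isOpen_Iio w hw) (hF.continuousAt (Iio_mem_nhds hw))
  refine (hF.mono fun u hu => ?_).intervalIntegrable
  exact hu.2.trans_lt (max_lt ha hw)

/-- The solution of an autonomous differential equation `g' = b g` which moves towards an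
equilibrium `M` with `b x = O(M - x)`: it is the inverse function of `w ↦ ∫_{x₀}^w du / b u`,
which maps `(-∞, M)` onto `ℝ`. -/
theorem exists_solution_autonomous {b : ℝ → ℝ} {M C x₀ : ℝ} (hb : ContinuousOn b (Set.Iio M))
    (hpos : ∀ x < M, 0 < b x) (hC : 0 < C) (hle : ∀ x < M, b x ≤ C * (M - x)) (hx₀ : x₀ < M) :
    ∃ g : ℝ → ℝ, g 0 = x₀ ∧ StrictMono g ∧ (∀ t, g t < M) ∧ (∀ t, HasDerivAt g (b (g t)) t) ∧
      (∀ t, ∫ u in x₀..g t, (b u)⁻¹ = t) ∧ Tendsto g atTop (𝓝[<] M) := by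
  have hinv : ContinuousOn (fun u => (b u)⁻¹) (Set.Iio M) :=
    hb.inv₀ fun x hx => (hpos x hx).ne'
  set G : ℝ → ℝ := fun w => ∫ u in x₀..w, (b u)⁻¹ with hG
  have hGd : ∀ w < M, HasDerivAt G (b w)⁻¹ w := fun w hw =>
    hasDerivAt_integral_of_continuousOn_Iio hinv hx₀ hw
  have hGc : ContinuousOn G (Set.Iio M) := fun w hw => (hGd w hw).continuousAt.continuousWithinAt
  have hGm : StrictMonoOn G (Set.Iio M) := by
    refine strictMonoOn_of_deriv_pos (convex_Iio M) hGc fun w hw => ?_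
    rw [interior_Iio] at hw
    rw [(hGd w hw).deriv]
    exact inv_pos.2 (hpos w hw)
  have hG0 : G x₀ = 0 := by simp [hG]
  -- comparison with the case `b x = C * (M - x)`
  have hLm : MonotoneOn (fun w => G w + C⁻¹ * Real.log (M - w)) (Set.Iio M) := by
    have hd : ∀ w < M, HasDerivAt (fun w => G w + C⁻¹ * Real.log (M - w))
        ((b w)⁻¹ + C⁻¹ * (-1 / (M - w))) w := fun w hw =>
      (hGd w hw).add ((((hasDerivAt_id w).const_sub M).log (sub_pos.2 hw).ne').const_mul _)
    refine monotoneOn_of_deriv_nonneg (convex_Iio M)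
      (fun w hw => (hd w hw).continuousAt.continuousWithinAt)
      (fun w hw => (hd w (by simpa using hw)).differentiableAt.differentiableWithinAt)
      fun w hw => ?_
    rw [interior_Iio] at hw
    rw [(hd w hw).deriv]
    have h1 : (C * (M - w))⁻¹ ≤ (b w)⁻¹ := inv_anti₀ (hpos w hw) (hle w hw)
    rw [mul_inv] at h1
    rw [neg_div, mul_neg, one_div]
    linarith
  have hsurj : ∀ y, ∃ w < M, G w = y := by
    intro y
    set a := M - (M - x₀) * Real.exp (-(C * y)) with ha
    have hx₀' : 0 < M - x₀ := sub_pos.2 hx₀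
    have haM : a < M := by
      have : 0 < (M - x₀) * Real.exp (-(C * y)) := by positivity
      linarith
    have hlog : C⁻¹ * Real.log (M - a) = C⁻¹ * Real.log (M - x₀) - y := by
      rw [show M - a = (M - x₀) * Real.exp (-(C * y)) by rw [ha]; ring,
        Real.log_mul hx₀'.ne' (Real.exp_pos _).ne', Real.log_exp]
      field_simp
      ring
    rcases le_total x₀ a with h | h
    · have h1 := hLm hx₀ haM h
      simp only [hG0, hlog] at h1
      have hy0 : 0 ≤ y := by
        by_contra hy
        have : (1 : ℝ) < Real.exp (-(C * y)) := Real.one_lt_exp_iff.2 (by nlinarith)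
        nlinarith
      obtain ⟨w, hw, hwy⟩ := intermediate_value_Icc h
        (hGc.mono fun u hu => hu.2.trans_lt haM) (⟨by linarith, by linarith⟩ : y ∈ Set.Icc _ _)
      exact ⟨w, hw.2.trans_lt haM, hwy⟩
    · have h1 := hLm haM hx₀ h
      simp only [hG0, hlog] at h1
      have hy0 : y ≤ 0 := by
        by_contra hy
        have : Real.exp (-(C * y)) < 1 := Real.exp_lt_one_iff.2 (by nlinarith)
        nlinarith
      obtain ⟨w, hw, hwy⟩ := intermediate_value_Icc h
        (hGc.mono fun u hu => hu.2.trans_lt hx₀) (⟨by linarith, by linarith⟩ : y ∈ Set.Icc _ _)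
      exact ⟨w, hw.2.trans_lt hx₀, hwy⟩
  have hmono : StrictMono fun w : Set.Iio M => G w := fun u v huv => hGm u.2 v.2 huv
  set e : Set.Iio M ≃o ℝ := hmono.orderIsoOfSurjective _ fun y => by
    obtain ⟨w, hw, hwy⟩ := hsurj y
    exact ⟨⟨w, hw⟩, hwy⟩ with he
  have heG : ∀ t, G (e.symm t) = t := fun t => e.apply_symm_apply t
  have hlt : ∀ t, (e.symm t : ℝ) < M := fun t => (e.symm t).2
  have hsm : StrictMono fun t => (e.symm t : ℝ) := fun s t h => e.symm.strictMono h
  refine ⟨fun t => e.symm t, ?_, hsm, hlt, fun t => ?_, heG, ?_⟩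
  · exact hGm.injOn (hlt 0) hx₀ ((heG 0).trans hG0.symm)
  · have hc : Continuous fun t => (e.symm t : ℝ) := continuous_subtype_val.comp e.symm.continuous
    have := (hGd _ (hlt t)).of_local_left_inverse (g := fun t => (e.symm t : ℝ)) hc.continuousAt
      (inv_pos.2 (hpos _ (hlt t))).ne' (Eventually.of_forall heG)
    simpa using this
  · rw [tendsto_nhdsWithin_iff]
    refine ⟨?_, Eventually.of_forall hlt⟩
    refine tendsto_order.2 ⟨fun a ha => ?_, fun a ha => Eventually.of_forall fun t => (hlt t).trans ha⟩
    filter_upwards [eventually_gt_atTop (G a)] with t ht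
    rw [← heG t] at ht
    exact (hGm.lt_iff_lt ha (hlt t)).1 ht

/-! ### Threshold policies -/

lemma ae_le_of_isLUB_cdf_lt_one {ν : Measure ℝ} [IsProbabilityMeasure ν] {M : ℝ}
    (hM : IsLUB {x : ℝ | cdf ν x < 1} M) : ∀ᵐ y ∂ν, y ≤ M := by
  have h1 : ∀ u, M < u → cdf ν u = 1 := fun u hu =>
    le_antisymm (cdf_le_one ν u) (not_lt.1 fun h => (hM.1 h).not_gt hu)
  have h2 : cdf ν M = 1 := by
    have hc : Tendsto (cdf ν) (𝓝[>] M) (𝓝 (cdf ν M)) :=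
      ((cdf ν).right_continuous M).mono_left (nhdsWithin_mono _ Set.Ioi_subset_Ici_self)
    refine tendsto_nhds_unique hc (tendsto_const_nhds.congr' ?_)
    filter_upwards [self_mem_nhdsWithin] with u hu using (h1 u hu).symm
  rw [cdf_eq_real] at h2
  have h3 : ν.real (Set.Iic M)ᶜ = 0 := by
    rw [probReal_compl_eq_one_sub measurableSet_Iic, h2, sub_self]
  rw [measureReal_eq_zero_iff] at h3
  exact h3

lemma measure_Ioi_ne_zero_of_isLUB_cdf_lt_one {ν : Measure ℝ} [IsProbabilityMeasure ν] {M : ℝ}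
    (hM : IsLUB {x : ℝ | cdf ν x < 1} M) {x : ℝ} (hx : x < M) : ν (Set.Ioi x) ≠ 0 := by
  obtain ⟨y, hy, hxy⟩ := (lt_isLUB_iff hM).1 hx
  intro h
  have h1 : cdf ν y < 1 := hy
  have h2 : ν.real (Set.Ioi x) = 0 := by rw [measureReal_def, h, ENNReal.toReal_zero]
  rw [← Set.compl_Iic, probReal_compl_eq_one_sub measurableSet_Iic, ← cdf_eq_real] at h2
  linarith [monotone_cdf ν hxy.le]

/-- The payoff at the next offer of the policy which accepts an offer if it is at least `g` of the
remaining time, when `s` is the time remaining, `z` consists of the duration until the next offer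
and its price, a sale at price `x` is worth `f x`, and the remaining time `r` is worth `w r`.
Prices are truncated at `M`. -/
def thresholdPayoff (M : ℝ) (g f w : ℝ → ℝ) (s : ℝ) (z : ℝ × ℝ) : ℝ :=
  if 0 < max (s - z.1) 0 ∧ g (max (s - z.1) 0) ≤ z.2 then f (min z.2 M) else w (max (s - z.1) 0)

section ThresholdPolicy

variable {ν : Measure ℝ} {lam M C : ℝ} {g f w : ℝ → ℝ}

lemma measurable_thresholdPayoff (hg : Measurable g) (hf : Measurable f) (hw : Measurable w) :
    Measurable fun q : ℝ × ℝ × ℝ => thresholdPayoff M g f w q.1 q.2 := by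
  have h1 : Measurable fun q : ℝ × ℝ × ℝ => max (q.1 - q.2.1) 0 := by fun_prop
  have h2 : Measurable fun q : ℝ × ℝ × ℝ => min q.2.2 M := by fun_prop
  refine Measurable.ite ?_ (hf.comp h2) (hw.comp h1)
  exact (h1 measurableSet_Ioi).inter (measurableSet_le (hg.comp h1) (by fun_prop))

lemma abs_thresholdPayoff_le (hgM : ∀ s, g s ≤ M) (hwC : ∀ s, |w s| ≤ C)
    (hfC : ∀ s x, g s ≤ x → x ≤ M → |f x| ≤ C) (s : ℝ) (z : ℝ × ℝ) :
    |thresholdPayoff M g f w s z| ≤ C := by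
  rw [thresholdPayoff]
  split_ifs with h
  · exact hfC _ _ (le_min h.2 (hgM _)) (min_le_right _ _)
  · exact hwC _

/-- The differential equation satisfied by the value `w` of a threshold policy is the infinitesimal
form of the equation saying that `w` is the mean payoff at the next offer. -/
lemma integral_thresholdPayoff [IsProbabilityMeasure ν] (hlam : 0 < lam)
    (hM : ∀ᵐ y ∂ν, y ≤ M) (hg : Measurable g)
    (hgM : ∀ s, g s ≤ M) (hf : Measurable f) (hw : Continuous w) (hwC : ∀ s, |w s| ≤ C)
    (hfC : ∀ s x, g s ≤ x → x ≤ M → |f x| ≤ C) (hw0 : ∀ s ≤ 0, w s = w 0)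
    {S : Set ℝ} (hS : S.Countable)
    (hd : ∀ r, 0 < r → r ∉ S →
      HasDerivAt w (lam * (∫ x, (if g r ≤ x then f x else w r) ∂ν - w r)) r) (s : ℝ) :
    ∫ z, thresholdPayoff M g f w s z ∂((expMeasure lam).prod ν) = w s := by
  have := isProbabilityMeasure_expMeasure hlam
  have hΦm := measurable_thresholdPayoff (M := M) hg hf hw.measurable
  have hint : Integrable (thresholdPayoff M g f w s) ((expMeasure lam).prod ν) :=
    Integrable.of_bound (hΦm.comp measurable_prodMk_left).aestronglyMeasurable C
      (Eventually.of_forall (abs_thresholdPayoff_le hgM hwC hfC s))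
  have htrunc : ∀ r, ∫ x, (if g r ≤ x then f (min x M) else w r) ∂ν =
      ∫ x, (if g r ≤ x then f x else w r) ∂ν := fun r => by
    refine integral_congr_ae ?_
    filter_upwards [hM] with x hx
    rw [min_eq_left hx]
  have hhm : Measurable fun r => ∫ x, (if g r ≤ x then f (min x M) else w r) ∂ν := by
    refine StronglyMeasurable.measurable ?_
    refine StronglyMeasurable.integral_prod_right
      (f := fun r x => if g r ≤ x then f (min x M) else w r) (Measurable.stronglyMeasurable ?_)
    refine Measurable.ite (measurableSet_le (hg.comp measurable_fst) measurable_snd) ?_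
      (hw.measurable.comp measurable_fst)
    exact hf.comp (by fun_prop)
  have hhC : ∀ r, |∫ x, (if g r ≤ x then f (min x M) else w r) ∂ν| ≤ C := fun r => by
    rw [← Real.norm_eq_abs]
    refine (norm_integral_le_of_norm_le_const (μ := ν) (C := C)
      (Eventually.of_forall fun x => ?_)).trans (by simp)
    split_ifs with h
    · exact hfC _ _ (le_min h (hgM _)) (min_le_right _ _)
    · exact hwC _
  have key := integral_expMeasure_of_hasDerivAt hlam hw hhm hhC hS
    (fun r hr hrS => by rw [htrunc]; exact hd r hr hrS) s
  rw [integral_prod _ hint]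
  have hws : w (max s 0) = w s := by
    rcases le_total s 0 with h | h
    · rw [max_eq_right h, hw0 s h]
    · rw [max_eq_left h]
  rw [← hws, ← key]
  refine integral_congr_ae (Eventually.of_forall fun d => ?_)
  simp only [thresholdPayoff]
  split_ifs with h
  · simp [h]
  · have h' : max (s - d) 0 = 0 := le_antisymm (not_lt.1 h) (le_max_right _ _)
    simp [h']

end ThresholdPolicy

namespace BiddingProcess

section

variable {Ω : Type*} [MeasurableSpace Ω] {P : Measure Ω} {lam : ℝ} {ν ν₀ : Measure ℝ}
  (B : BiddingProcess P lam ν ν₀) {M C : ℝ} {g f : ℝ → ℝ}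

lemma ae_X_le (hM : ∀ᵐ y ∂ν, y ≤ M) : ∀ᵐ ω ∂P, ∀ n, B.X n ω ≤ M := by
  rw [ae_all_iff]
  intro n
  rw [← (B.law_X n).map_eq] at hM
  exact ae_of_ae_map (B.measurable_X n).aemeasurable hM

lemma ae_abs_comp_salePrice_le (hM : ∀ᵐ y ∂ν, y ≤ M)
    (hfC : ∀ s x, g s ≤ x → x ≤ M → |f x| ≤ C) (t : ℝ) :
    ∀ᵐ ω ∂P, |f (B.salePrice {q | g q.1 ≤ q.2} t ω)| ≤ |C| + |f (B.X₀ ω)| := by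
  filter_upwards [B.ae_X_le hM] with ω hω
  by_cases h : ∃ n, B.Accepts {q | g q.1 ≤ q.2} t ω n
  · obtain ⟨n, hn, ha⟩ := B.exists_pending_of_accepts h
    rw [B.salePrice_of_pending hn ha]
    exact ((hfC _ _ ha.2 (hω n)).trans (le_abs_self C)).trans
      (le_add_of_nonneg_right (abs_nonneg _))
  · push Not at h
    rw [B.salePrice_of_forall_not h]
    exact le_add_of_nonneg_left (abs_nonneg _)

end

variable {Ω : Type*} [MeasurableSpace Ω] {P : Measure Ω} [IsProbabilityMeasure P] {lam : ℝ}
  {ν ν₀ : Measure ℝ} (B : BiddingProcess P lam ν ν₀) {M C : ℝ}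
  {g f w : ℝ → ℝ}

lemma measurableSet_thresholdPolicy (hg : Measurable g) :
    MeasurableSet {q : ℝ × ℝ | g q.1 ≤ q.2} :=
  measurableSet_le (hg.comp measurable_fst) measurable_snd

lemma integrable_comp_salePrice (hM : ∀ᵐ y ∂ν, y ≤ M) (hg : Measurable g) (hf : Measurable f)
    (hfC : ∀ s x, g s ≤ x → x ≤ M → |f x| ≤ C) (hint₀ : Integrable (fun ω => f (B.X₀ ω)) P)
    (t : ℝ) : Integrable (fun ω => f (B.salePrice {q | g q.1 ≤ q.2} t ω)) P :=
  ((integrable_const |C|).add hint₀.abs).mono'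
    (hf.comp (B.measurable_salePrice (measurableSet_thresholdPolicy hg) t)).aestronglyMeasurable
    (B.ae_abs_comp_salePrice_le hM hfC t)

/-- The mean of `f` of the sale price under a threshold policy, as the solution `w` of a
differential equation. -/
theorem integral_comp_salePrice_threshold [IsProbabilityMeasure ν] (hlam : 0 < lam) (hM : ∀ᵐ y ∂ν, y ≤ M)
    (hg : Measurable g) (hgM : ∀ s, g s ≤ M) (hf : Measurable f) (hw : Continuous w)
    (hwC : ∀ s, |w s| ≤ C) (hfC : ∀ s x, g s ≤ x → x ≤ M → |f x| ≤ C)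
    (hw0 : ∀ s ≤ 0, w s = w 0) {S : Set ℝ} (hS : S.Countable)
    (hd : ∀ r, 0 < r → r ∉ S →
      HasDerivAt w (lam * (∫ x, (if g r ≤ x then f x else w r) ∂ν - w r)) r)
    (hint₀ : Integrable (fun ω => f (B.X₀ ω)) P) (hinit : w 0 = ∫ ω, f (B.X₀ ω) ∂P) (t : ℝ) :
    ∫ ω, f (B.salePrice {q | g q.1 ≤ q.2} t ω) ∂P = w t := by
  have hA := measurableSet_thresholdPolicy hg
  have hint := B.integrable_comp_salePrice hM hg hf hfC hint₀ t
  have hΦm := measurable_thresholdPayoff (M := M) hg hf hw.measurable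
  have hΦC := abs_thresholdPayoff_le hgM hwC hfC
  have hΦ := integral_thresholdPayoff hlam hM hg hgM hf hw hwC hfC hw0 hS hd
  refine le_antisymm ?_ (neg_le_neg_iff.1 ?_)
  · refine B.integral_comp_salePrice_le hlam hA hf hint hint₀ hwC hinit hΦm hΦC hΦ
      (E := Set.Iic M) hM ?_ ?_
    · intro s d x hx h1 h2
      rw [thresholdPayoff, if_pos ⟨h1, h2⟩, min_eq_left hx]
    · intro s d x hx h
      have h' : ¬(0 < max (s - d) 0 ∧ g (max (s - d) 0) ≤ x) := h
      simp only [thresholdPayoff, if_neg h', le_refl]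
  · rw [← integral_neg]
    refine B.integral_comp_salePrice_le (f := fun x => -f x) (w := fun s => -w s)
      (Φ := fun s z => -thresholdPayoff M g f w s z) hlam hA hf.neg hint.neg hint₀.neg
      (fun s => by rw [abs_neg]; exact hwC s) (by rw [hinit, integral_neg]) hΦm.neg
      (fun s z => by rw [abs_neg]; exact hΦC s z) (fun s => by rw [integral_neg, hΦ])
      (E := Set.Iic M) hM ?_ ?_
    · intro s d x hx h1 h2
      rw [thresholdPayoff, if_pos ⟨h1, h2⟩, min_eq_left hx]
    · intro s d x hx h
      have h' : ¬(0 < max (s - d) 0 ∧ g (max (s - d) 0) ≤ x) := h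
      simp only [thresholdPayoff, if_neg h', le_refl]

end BiddingProcess

/-! ### The optimal value and the variance of the optimal sale price -/

lemma HasDerivAt.comp_max_zero {w : ℝ → ℝ} {w' r : ℝ} (hr : 0 < r) (h : HasDerivAt w w' r) :
    HasDerivAt (fun s => w (max s 0)) w' r := by
  refine h.congr_of_eventuallyEq ?_
  filter_upwards [eventually_gt_nhds hr] with s hs
  rw [max_eq_left hs.le]

/-- The ratio of the variance of the optimal sale price to `φ`, as a function of the reservation
price `w`; here `φ` is the mean excess of `ν` and `V₀` is the variance of the residual price. -/
def varianceRatio (ν : Measure ℝ) (μ₀ V₀ w : ℝ) : ℝ :=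
  V₀ / meanExcess ν μ₀ + ∫ u in μ₀..w, sqExcess ν u / meanExcess ν u ^ 2

lemma varianceRatio_nonneg {ν : Measure ℝ} {μ₀ V₀ : ℝ} (hV₀ : 0 ≤ V₀) {w : ℝ} (hw : μ₀ ≤ w) :
    0 ≤ varianceRatio ν μ₀ V₀ w :=
  add_nonneg (div_nonneg hV₀ (meanExcess_nonneg _ _)) (intervalIntegral.integral_nonneg hw
    fun _ _ => div_nonneg (sqExcess_nonneg _ _) (sq_nonneg _))

section ReservationPrice

variable {ν : Measure ℝ} [IsProbabilityMeasure ν] {M μ₀ V₀ : ℝ}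

lemma continuousOn_sqExcess_div (hM : ∀ᵐ y ∂ν, y ≤ M) (hν : ∀ x < M, ν (Set.Ioi x) ≠ 0) :
    ContinuousOn (fun u => sqExcess ν u / meanExcess ν u ^ 2) (Set.Iio M) :=
  (continuous_sqExcess hM).continuousOn.div ((continuous_meanExcess hM).pow 2).continuousOn
    fun x hx => (pow_pos (meanExcess_pos hM (hν x hx)) 2).ne'

lemma hasDerivAt_varianceRatio (hM : ∀ᵐ y ∂ν, y ≤ M) (hν : ∀ x < M, ν (Set.Ioi x) ≠ 0)
    (hμ₀ : μ₀ < M) (V₀ : ℝ) {w : ℝ} (hw : w < M) :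
    HasDerivAt (varianceRatio ν μ₀ V₀) (sqExcess ν w / meanExcess ν w ^ 2) w :=
  (hasDerivAt_integral_of_continuousOn_Iio (continuousOn_sqExcess_div hM hν) hμ₀ hw).const_add _

lemma meanExcess_mul_varianceRatio_le (hM : ∀ᵐ y ∂ν, y ≤ M)
    (hν : ∀ x < M, ν (Set.Ioi x) ≠ 0) (hV₀ : 0 ≤ V₀) {w : ℝ} (hw : μ₀ ≤ w) (hwM : w < M) :
    meanExcess ν w * varianceRatio ν μ₀ V₀ w ≤ V₀ + (M - μ₀) ^ 2 := by
  have hpos : ∀ u ≤ w, 0 < meanExcess ν u := fun u hu =>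
    meanExcess_pos hM (hν u (hu.trans_lt hwM))
  rw [varianceRatio, mul_add, ← intervalIntegral.integral_const_mul]
  have h1 : meanExcess ν w * (V₀ / meanExcess ν μ₀) ≤ V₀ := by
    rw [mul_div_left_comm]
    exact mul_le_of_le_one_right hV₀ ((div_le_one (hpos _ hw)).2 (meanExcess_antitone hM hw))
  have h2 : ∫ u in μ₀..w, meanExcess ν w * (sqExcess ν u / meanExcess ν u ^ 2) ≤
      ∫ _ in μ₀..w, (M - μ₀) := by
    refine intervalIntegral.integral_mono_on hw ?_ (by simp) fun u hu => ?_
    · refine (ContinuousOn.intervalIntegrable ?_).const_mul _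
      refine (continuousOn_sqExcess_div hM hν).mono fun u hu => ?_
      rw [Set.uIcc_of_le hw] at hu
      exact hu.2.trans_lt hwM
    · have hp := hpos u hu.2
      calc meanExcess ν w * (sqExcess ν u / meanExcess ν u ^ 2)
          ≤ meanExcess ν u * ((M - u) * meanExcess ν u / meanExcess ν u ^ 2) := by
            gcongr
            · exact div_nonneg (sqExcess_nonneg _ _) (sq_nonneg _)
            · exact meanExcess_antitone hM hu.2
            · exact sqExcess_le hM (hu.2.trans hwM.le)
        _ = M - u := by field_simp
        _ ≤ M - μ₀ := by linarith [hu.1]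
  rw [intervalIntegral.integral_const, smul_eq_mul] at h2
  nlinarith

lemma integral_ite_le_self (hM : ∀ᵐ y ∂ν, y ≤ M) (a : ℝ) :
    ∫ x, (if a ≤ x then x else a) ∂ν = a + meanExcess ν a := by
  have h : ∀ x : ℝ, (if a ≤ x then x else a) = a + max (x - a) 0 := fun x => by
    split_ifs with h
    · rw [max_eq_left (sub_nonneg.2 h)]; ring
    · rw [max_eq_right (by linarith)]; ring
  simp only [h]
  rw [integral_add (integrable_const _) (integrable_excess hM a)]
  simp [meanExcess]

lemma integral_ite_le_sq (hM : ∀ᵐ y ∂ν, y ≤ M) {a : ℝ} (ha : ν {a} = 0) (m : ℝ) :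
    ∫ x, (if a ≤ x then x ^ 2 else m) ∂ν =
      sqExcess ν a + 2 * a * meanExcess ν a + (a ^ 2 - m) * ν.real (Set.Ioi a) + m := by
  have h : ∀ x : ℝ, (if a ≤ x then x ^ 2 else m) = (max (x - a) 0 ^ 2 + 2 * a * max (x - a) 0) +
      ((Set.Ici a).indicator (fun _ => a ^ 2 - m) x + m) := fun x => by
    split_ifs with h
    · rw [max_eq_left (sub_nonneg.2 h), Set.indicator_of_mem (by simpa using h)]; ring
    · rw [max_eq_right (by linarith), Set.indicator_of_notMem (by simpa using h)]; ring
  simp only [h]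
  have i1 := integrable_excess_sq hM a
  have i2 : Integrable (fun x => 2 * a * max (x - a) 0) ν := (integrable_excess hM a).const_mul _
  have i3 : Integrable ((Set.Ici a).indicator fun _ => a ^ 2 - m) ν :=
    (integrable_const _).indicator measurableSet_Ici
  have hIci : ν.real (Set.Ici a) = ν.real (Set.Ioi a) := by
    refine measureReal_congr ?_
    exact (Ioi_ae_eq_Ici' ha).symm
  have i12 : Integrable (fun x => max (x - a) 0 ^ 2 + 2 * a * max (x - a) 0) ν := i1.add i2
  have i34 : Integrable (fun x => (Set.Ici a).indicator (fun _ => a ^ 2 - m) x + m) ν :=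
    i3.add (integrable_const _)
  rw [integral_add i12 i34, integral_add i1 i2, integral_add i3 (integrable_const _),
    integral_const_mul, integral_indicator measurableSet_Ici]
  simp only [integral_const, measureReal_restrict_apply_univ, hIci, probReal_univ, smul_eq_mul,
    one_mul, sqExcess, meanExcess]
  ring

end ReservationPrice

namespace BiddingProcess

variable {Ω : Type*} [MeasurableSpace Ω] {P : Measure Ω} [IsProbabilityMeasure P] {lam : ℝ}
  {ν ν₀ : Measure ℝ} [IsProbabilityMeasure ν] (B : BiddingProcess P lam ν ν₀) {M μ₀ : ℝ}
  {g : ℝ → ℝ}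

/-- The solution `g` of the differential equation `g' = λ φ(g)`, `g 0 = E X₀`, is the mean sale
price of the policy with reservation price `g`, and no policy does better. The value is constant for
negative times, at which the deadline has passed. -/
theorem isGreatest_achievable (hlam : 0 < lam) (hM : ∀ᵐ y ∂ν, y ≤ M)
    (hX₀ : Integrable B.X₀ P) (hμ₀ : μ₀ = ∫ ω, B.X₀ ω ∂P) (hμ₀_nonneg : 0 ≤ μ₀)
    (hg0 : g 0 = μ₀) (hgmono : StrictMono g) (hgM : ∀ t, g t < M)
    (hgd : ∀ t, HasDerivAt g (lam * meanExcess ν (g t)) t) (t : ℝ) :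
    Integrable (B.salePrice {q | g (max q.1 0) ≤ q.2} t) P ∧
    ∫ ω, B.salePrice {q | g (max q.1 0) ≤ q.2} t ω ∂P = g (max t 0) ∧
    IsGreatest (B.achievable t) (g (max t 0)) := by
  have hgc : Continuous g := continuous_iff_continuousAt.2 fun t => (hgd t).continuousAt
  have hG : Continuous fun s => g (max s 0) := by fun_prop
  have hGnn : ∀ s, 0 ≤ g (max s 0) := fun s =>
    hμ₀_nonneg.trans (hg0 ▸ hgmono.monotone (le_max_right s 0))
  have hGM : ∀ s, g (max s 0) ≤ M := fun s => (hgM _).le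
  have hGC : ∀ s, |g (max s 0)| ≤ M := fun s => by
    rw [abs_of_nonneg (hGnn s)]; exact hGM s
  have hfC : ∀ s x, g (max s 0) ≤ x → x ≤ M → |id x| ≤ M := fun s x h1 h2 => by
    rw [id, abs_of_nonneg ((hGnn s).trans h1)]; exact h2
  have hG0 : ∀ s ≤ 0, g (max s 0) = g (max 0 0) := fun s hs => by
    rw [max_eq_right hs, max_self]
  have hinit : g (max 0 0) = ∫ ω, id (B.X₀ ω) ∂P := by rw [max_self, hg0, hμ₀]; rfl
  have hode : ∀ r, 0 < r → r ∉ (∅ : Set ℝ) → HasDerivAt (fun s => g (max s 0))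
      (lam * (∫ x, (if g (max r 0) ≤ x then id x else g (max r 0)) ∂ν - g (max r 0))) r := by
    intro r hr _
    simp only [id]
    rw [integral_ite_le_self hM, add_sub_cancel_left]
    refine HasDerivAt.comp_max_zero hr ?_
    rw [max_eq_left hr.le]
    exact hgd r
  have hint : Integrable (B.salePrice {q | g (max q.1 0) ≤ q.2} t) P :=
    B.integrable_comp_salePrice hM hG.measurable measurable_id hfC hX₀ t
  have hval : ∫ ω, B.salePrice {q | g (max q.1 0) ≤ q.2} t ω ∂P = g (max t 0) :=
    B.integral_comp_salePrice_threshold hlam hM hG.measurable hGM measurable_id hG hGC hfC hG0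
      Set.countable_empty hode hX₀ hinit t
  refine ⟨hint, hval, ⟨_, measurableSet_thresholdPolicy hG.measurable, hint, hval.symm⟩, ?_⟩
  rintro _ ⟨A, hA, hAint, rfl⟩
  refine B.integral_comp_salePrice_le (f := id) hlam hA measurable_id hAint hX₀ hGC hinit
    (measurable_thresholdPayoff (M := M) hG.measurable measurable_id hG.measurable)
    (abs_thresholdPayoff_le hGM hGC hfC)
    (integral_thresholdPayoff hlam hM hG.measurable hGM measurable_id hG hGC hfC hG0
      Set.countable_empty hode) (E := Set.Iic M) hM ?_ ?_
  -- the payoff of the reservation price is the larger one of the offer and the value of waiting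
  · intro s d x hx h1 _
    have hx' : x ≤ M := hx
    simp only [thresholdPayoff, h1, true_and, id, min_eq_left hx']
    split_ifs with h
    · exact le_rfl
    · exact (not_le.1 h).le
  · intro s d x hx _
    have hx' : x ≤ M := hx
    simp only [thresholdPayoff, id, min_eq_left hx']
    split_ifs with h
    · simpa using h.2
    · exact le_rfl

/-- Second moment of the sale price under the policy with reservation price `g`. The function
`v = φ(g) * K(g)` solves the linear equation `v' = λ (ψ(g) - P(X > g) v)`, where `K` has
derivative `ψ / φ ^ 2`, because `φ(g)` solves the homogeneous equation. -/
theorem integral_sq_salePrice (hlam : 0 < lam) (hM : ∀ᵐ y ∂ν, y ≤ M)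
    (hν : ∀ x < M, ν (Set.Ioi x) ≠ 0) (hX₀ : MemLp B.X₀ 2 P) (hμ₀ : μ₀ = ∫ ω, B.X₀ ω ∂P)
    (hμ₀_nonneg : 0 ≤ μ₀) (hμ₀_lt : μ₀ < M)
    (hg0 : g 0 = μ₀) (hgmono : StrictMono g) (hgM : ∀ t, g t < M)
    (hgd : ∀ t, HasDerivAt g (lam * meanExcess ν (g t)) t) (t : ℝ) :
    Integrable (fun ω => B.salePrice {q | g (max q.1 0) ≤ q.2} t ω ^ 2) P ∧
    ∫ ω, B.salePrice {q | g (max q.1 0) ≤ q.2} t ω ^ 2 ∂P =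
      meanExcess ν (g (max t 0)) * varianceRatio ν μ₀ (variance B.X₀ P) (g (max t 0)) +
        g (max t 0) ^ 2 := by
  set V₀ := variance B.X₀ P with hV₀
  have hV₀nn : 0 ≤ V₀ := variance_nonneg _ _
  have hgc : Continuous g := continuous_iff_continuousAt.2 fun t => (hgd t).continuousAt
  have hG : Continuous fun s => g (max s 0) := by fun_prop
  have hGge : ∀ s, μ₀ ≤ g (max s 0) := fun s => hg0 ▸ hgmono.monotone (le_max_right s 0)
  have hGnn : ∀ s, 0 ≤ g (max s 0) := fun s => hμ₀_nonneg.trans (hGge s)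
  have hGM : ∀ s, g (max s 0) ≤ M := fun s => (hgM _).le
  set m : ℝ → ℝ := fun s => meanExcess ν (g s) * varianceRatio ν μ₀ V₀ (g s) + g s ^ 2 with hm
  have hKc : ContinuousOn (varianceRatio ν μ₀ V₀) (Set.Iio M) := fun w hw =>
    (hasDerivAt_varianceRatio hM hν hμ₀_lt V₀ hw).continuousAt.continuousWithinAt
  have hmc : Continuous m :=
    (((continuous_meanExcess hM).comp hgc).mul (hKc.comp_continuous hgc hgM)).add (hgc.pow 2)
  have hmC : ∀ s, |m (max s 0)| ≤ V₀ + (M - μ₀) ^ 2 + M ^ 2 := fun s => by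
    have h1 := meanExcess_mul_varianceRatio_le hM hν hV₀nn (hGge s) (hgM _)
    have h2 : g (max s 0) ^ 2 ≤ M ^ 2 := pow_le_pow_left₀ (hGnn s) (hGM s) 2
    have h3 : 0 ≤ m (max s 0) := add_nonneg (mul_nonneg (meanExcess_nonneg _ _)
      (varianceRatio_nonneg hV₀nn (hGge s))) (sq_nonneg _)
    rw [abs_of_nonneg h3]
    simp only [hm]
    linarith
  have hfC : ∀ s x, g (max s 0) ≤ x → x ≤ M → |x ^ 2| ≤ V₀ + (M - μ₀) ^ 2 + M ^ 2 :=
    fun s x h1 h2 => by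
      rw [abs_of_nonneg (sq_nonneg x)]
      have := pow_le_pow_left₀ ((hGnn s).trans h1) h2 2
      nlinarith [sq_nonneg (M - μ₀)]
  have hX₀sq : Integrable (fun ω => B.X₀ ω ^ 2) P := hX₀.integrable_sq
  have hinit : m (max 0 0) = ∫ ω, B.X₀ ω ^ 2 ∂P := by
    have hpos := meanExcess_pos hM (hν μ₀ hμ₀_lt)
    have hvar : V₀ = ∫ ω, B.X₀ ω ^ 2 ∂P - μ₀ ^ 2 := by rw [hV₀, variance_eq_sub hX₀, hμ₀]; rfl
    simp only [hm, max_self, hg0, varianceRatio, intervalIntegral.integral_same, add_zero]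
    rw [mul_div_cancel₀ _ hpos.ne', hvar]
    ring
  have hode : ∀ r, 0 < r → r ∉ g ⁻¹' {x | ν {x} ≠ 0} → HasDerivAt (fun s => m (max s 0))
      (lam * (∫ x, (if g (max r 0) ≤ x then x ^ 2 else m (max r 0)) ∂ν - m (max r 0))) r := by
    intro r hr hrS
    have hat : ν {g r} = 0 := by simpa using hrS
    refine HasDerivAt.comp_max_zero hr ?_
    rw [max_eq_left hr.le, integral_ite_le_sq hM hat]
    have hpos := meanExcess_pos hM (hν _ (hgM r))
    have e1 := (hasDerivAt_meanExcess hM hat).comp r (hgd r)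
    have e2 := (hasDerivAt_varianceRatio hM hν hμ₀_lt V₀ (hgM r)).comp r (hgd r)
    have e3 := (e1.mul e2).add ((hgd r).pow 2)
    convert! e3 using 1
    simp only [hm, Function.comp_apply]
    field_simp
    ring
  refine ⟨B.integrable_comp_salePrice (f := fun x => x ^ 2) hM hG.measurable (by fun_prop) hfC
    hX₀sq t, ?_⟩
  exact B.integral_comp_salePrice_threshold (f := fun x => x ^ 2) (w := fun s => m (max s 0))
    hlam hM hG.measurable hGM (by fun_prop) (by fun_prop) hmC hfC
    (fun s hs => by rw [max_eq_right hs, max_self])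
    ((countable_atoms ν).preimage_of_injOn hgmono.injective.injOn) hode hX₀sq hinit t

end BiddingProcess

/-! ### Asymptotics at the right end of the support -/

section LHopital

/-- L'Hôpital's rule from the left for a denominator which tends to infinity. -/
theorem tendsto_div_of_tendsto_deriv_div_atTop {M L : ℝ} {f f' k k' : ℝ → ℝ}
    (hf : ∀ᶠ x in 𝓝[<] M, HasDerivAt f (f' x) x) (hk : ∀ᶠ x in 𝓝[<] M, HasDerivAt k (k' x) x)
    (hk' : ∀ᶠ x in 𝓝[<] M, 0 < k' x) (hkt : Tendsto k (𝓝[<] M) atTop)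
    (hdiv : Tendsto (fun x => f' x / k' x) (𝓝[<] M) (𝓝 L)) :
    Tendsto (fun x => f x / k x) (𝓝[<] M) (𝓝 L) := by
  rw [Metric.tendsto_nhds]
  intro ε hε
  have hev : ∀ᶠ x in 𝓝[<] M, HasDerivAt f (f' x) x ∧ HasDerivAt k (k' x) x ∧
      |f' x - L * k' x| ≤ ε / 2 * k' x := by
    filter_upwards [hf, hk, hk', Metric.tendsto_nhds.1 hdiv (ε / 2) (half_pos hε)]
      with x h1 h2 h3 h4
    refine ⟨h1, h2, ?_⟩
    rw [Real.dist_eq] at h4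
    calc |f' x - L * k' x| = |f' x / k' x - L| * k' x := by
          rw [← abs_of_pos h3, ← abs_mul, abs_of_pos h3]
          congr 1
          field_simp
      _ ≤ ε / 2 * k' x := by gcongr
  obtain ⟨a, ha, hsub⟩ := mem_nhdsLT_iff_exists_Ioo_subset.1 hev
  have ha' : a < M := ha
  obtain ⟨b, hab, hbM⟩ := exists_between ha'
  -- `f - L k` varies by at most `ε / 2` times the variation of `k` on `(a, M)`
  have hmono : ∀ σ : ℝ, |σ| = 1 →
      AntitoneOn (fun x => σ * (f x - L * k x) - ε / 2 * k x) (Set.Ioo a M) := by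
    intro σ hσ
    have hd : ∀ x ∈ Set.Ioo a M, HasDerivAt (fun x => σ * (f x - L * k x) - ε / 2 * k x)
        (σ * (f' x - L * k' x) - ε / 2 * k' x) x := fun x hx =>
      ((((hsub hx).1.sub ((hsub hx).2.1.const_mul L))).const_mul σ).sub
        ((hsub hx).2.1.const_mul (ε / 2))
    refine antitoneOn_of_deriv_nonpos (convex_Ioo a M)
      (fun x hx => (hd x hx).continuousAt.continuousWithinAt)
      (fun x hx => (hd x (interior_subset hx)).differentiableAt.differentiableWithinAt)
      fun x hx => ?_
    rw [interior_Ioo] at hx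
    rw [(hd x hx).deriv, sub_nonpos]
    refine (le_abs_self _).trans ?_
    rw [abs_mul, hσ, one_mul]
    exact (hsub hx).2.2
  have hlarge := hkt.eventually_gt_atTop
    (max 0 ((|f b - L * k b| + ε / 2 * |k b|) / (ε / 2)))
  filter_upwards [hlarge, Ioo_mem_nhdsLT hbM] with x hx hxb
  have hk0 : 0 < k x := (le_max_left _ _).trans_lt hx
  have hkx : |f b - L * k b| + ε / 2 * |k b| < ε / 2 * k x := by
    have := (le_max_right _ _).trans_lt hx
    rw [div_lt_iff₀ (half_pos hε)] at this
    linarith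
  have hbm : b ∈ Set.Ioo a M := ⟨hab, hbM⟩
  have hxm : x ∈ Set.Ioo a M := ⟨hab.trans hxb.1, hxb.2⟩
  have h1 := hmono 1 (by simp) hbm hxm hxb.1.le
  have h2 := hmono (-1) (by simp) hbm hxm hxb.1.le
  simp only [one_mul, neg_mul] at h1 h2
  have h3 := neg_abs_le (f b - L * k b)
  have h4 := le_abs_self (f b - L * k b)
  have h5 : ε / 2 * -|k b| ≤ ε / 2 * k b := by gcongr; exact neg_abs_le _
  have hdist : |f x - L * k x| < ε * k x := by
    rw [abs_lt]
    constructor <;> linarith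
  rw [Real.dist_eq, show f x / k x - L = (f x - L * k x) / k x by field_simp, abs_div,
    abs_of_pos hk0, div_lt_iff₀ hk0]
  exact hdist

lemma hasDerivAt_sub_rpow {M w : ℝ} (hw : w < M) (q : ℝ) :
    HasDerivAt (fun w => (M - w) ^ q) (-(q * (M - w) ^ (q - 1))) w := by
  have := ((hasDerivAt_id w).const_sub M).rpow_const (p := q) (Or.inl (sub_pos.2 hw).ne')
  simpa using this

lemma tendsto_sub_nhdsLT (M : ℝ) : Tendsto (fun w => M - w) (𝓝[<] M) (𝓝[>] 0) := by
  rw [tendsto_nhdsWithin_iff]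
  constructor
  · have : Tendsto (fun w : ℝ => M - w) (𝓝 M) (𝓝 (M - M)) := by
      apply Continuous.tendsto; fun_prop
    rw [sub_self] at this
    exact this.mono_left nhdsWithin_le_nhds
  · filter_upwards [self_mem_nhdsWithin] with w hw
    exact sub_pos.2 (Set.mem_Iio.1 hw)

lemma tendsto_sub_rpow_atTop (M : ℝ) {q : ℝ} (hq : 0 < q) :
    Tendsto (fun w => (M - w) ^ (-q)) (𝓝[<] M) atTop :=
  (tendsto_rpow_neg_nhdsGT_zero (neg_lt_zero.2 hq)).comp (tendsto_sub_nhdsLT M)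

/-- If `f' x ~ L (M - x) ^ (-(q + 1))` from the left of `M`, then `f x ~ L / q * (M - x) ^ (-q)`. -/
lemma tendsto_mul_sub_rpow {M L q : ℝ} {f f' : ℝ → ℝ} (hq : 0 < q)
    (hf : ∀ᶠ x in 𝓝[<] M, HasDerivAt f (f' x) x)
    (hdiv : Tendsto (fun x => f' x * (M - x) ^ (q + 1)) (𝓝[<] M) (𝓝 L)) :
    Tendsto (fun x => f x * (M - x) ^ q) (𝓝[<] M) (𝓝 (L / q)) := by
  have hlt : ∀ᶠ x in 𝓝[<] M, x < M := self_mem_nhdsWithin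
  have h := tendsto_div_of_tendsto_deriv_div_atTop (k := fun x => (M - x) ^ (-q))
    (k' := fun x => q * (M - x) ^ (-(q + 1))) (L := L / q) hf
    (hlt.mono fun x hx => by
      convert! hasDerivAt_sub_rpow hx (-q) using 1
      rw [neg_mul, neg_neg, neg_add'])
    (hlt.mono fun x hx => mul_pos hq (Real.rpow_pos_of_pos (sub_pos.2 hx) _))
    (tendsto_sub_rpow_atTop M hq) ?_
  · refine h.congr' ?_
    filter_upwards [hlt] with x hx
    rw [Real.rpow_neg (sub_pos.2 hx).le, div_inv_eq_mul]
  · refine (hdiv.div_const q).congr' ?_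
    filter_upwards [hlt] with x hx
    have := Real.rpow_pos_of_pos (sub_pos.2 hx) (q + 1)
    rw [Real.rpow_neg (sub_pos.2 hx).le]
    field_simp

end LHopital

lemma isEquivalent_const_mul_of_tendsto {v u : ℝ → ℝ} {L : ℝ} (hL : L ≠ 0)
    (hu : ∀ᶠ t in atTop, u t ≠ 0) (h : Tendsto (fun t => v t / u t) atTop (𝓝 L)) :
    v ~[atTop] fun t => L * u t := by
  rw [isEquivalent_iff_tendsto_one (hu.mono fun t ht => mul_ne_zero hL ht)]
  have h1 := h.div_const L
  rw [div_self hL] at h1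
  refine h1.congr' ?_
  filter_upwards [hu] with t ht
  simp only [Pi.div_apply]
  field_simp

section Edge

variable {ν : Measure ℝ} [IsProbabilityMeasure ν] {M μ₀ V₀ p c : ℝ}

lemma tendsto_sqExcess_div (hM : ∀ᵐ y ∂ν, y ≤ M) (hp : 0 < p)
    (hedge : Tendsto (fun x => meanExcess ν x / (M - x) ^ (p + 1)) (𝓝[<] M) (𝓝 c)) :
    Tendsto (fun x => sqExcess ν x / (M - x) ^ (p + 2)) (𝓝[<] M) (𝓝 (2 * c / (p + 2))) := by
  have hlt : ∀ᶠ x in 𝓝[<] M, x < M := self_mem_nhdsWithin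
  refine HasDerivAt.lhopital_zero_nhdsLT (f' := fun x => -(2 * meanExcess ν x))
    (g' := fun x => -((p + 2) * (M - x) ^ (p + 2 - 1)))
    (Eventually.of_forall fun x => hasDerivAt_sqExcess hM x)
    (hlt.mono fun x hx => hasDerivAt_sub_rpow hx (p + 2)) ?_ ?_ ?_ ?_
  · filter_upwards [hlt] with x hx
    have := Real.rpow_pos_of_pos (sub_pos.2 hx) (p + 2 - 1)
    have : 0 < (p + 2) * (M - x) ^ (p + 2 - 1) := by positivity
    linarith
  · have := (continuous_sqExcess hM).tendsto M
    rw [sqExcess_eq_zero hM] at this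
    exact this.mono_left nhdsWithin_le_nhds
  · have h1 : Tendsto (fun u : ℝ => u ^ (p + 2)) (𝓝 0) (𝓝 (0 ^ (p + 2))) :=
      (Real.continuousAt_rpow_const 0 (p + 2) (Or.inr (by linarith))).tendsto
    rw [Real.zero_rpow (by linarith)] at h1
    exact h1.comp ((tendsto_sub_nhdsLT M).mono_right nhdsWithin_le_nhds)
  · have := (hedge.const_mul 2).div_const (p + 2)
    refine this.congr' ?_
    filter_upwards [hlt] with x hx
    have h1 := Real.rpow_pos_of_pos (sub_pos.2 hx) (p + 1)
    rw [show p + 2 - 1 = p + 1 by ring, neg_div_neg_eq]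
    field_simp

/-- The derivative of the ratio of the variance to `φ`, near the right end `M` of the support. -/
lemma tendsto_sqExcess_div_sq_mul (hM : ∀ᵐ y ∂ν, y ≤ M) (hp : 0 < p) (hc : 0 < c)
    (hedge : Tendsto (fun x => meanExcess ν x / (M - x) ^ (p + 1)) (𝓝[<] M) (𝓝 c)) :
    Tendsto (fun x => sqExcess ν x / meanExcess ν x ^ 2 * (M - x) ^ p) (𝓝[<] M)
      (𝓝 (2 / (c * (p + 2)))) := by
  have h := (tendsto_sqExcess_div hM hp hedge).div (hedge.pow 2) (by positivity)
  rw [show 2 * c / (p + 2) / c ^ 2 = 2 / (c * (p + 2)) by field_simp] at h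
  refine h.congr' ?_
  filter_upwards [self_mem_nhdsWithin] with x hx
  have hpos : 0 < M - x := sub_pos.2 hx
  have h0 := Real.rpow_pos_of_pos hpos p
  simp only [Pi.div_apply]
  rw [Real.rpow_add hpos, Real.rpow_add hpos, Real.rpow_one, Real.rpow_ofNat]
  field_simp

/-- The exponent `p < 1` makes the integrand of the ratio of the variance to `φ` integrable up to
the right end `M` of the support. -/
lemma intervalIntegrable_sqExcess_div (hM : ∀ᵐ y ∂ν, y ≤ M) (hν : ∀ x < M, ν (Set.Ioi x) ≠ 0)
    (hμ₀ : μ₀ < M) (hp : 0 < p) (hp1 : p < 1) (hc : 0 < c)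
    (hedge : Tendsto (fun x => meanExcess ν x / (M - x) ^ (p + 1)) (𝓝[<] M) (𝓝 c)) :
    IntervalIntegrable (fun u => sqExcess ν u / meanExcess ν u ^ 2) volume μ₀ M := by
  set L := 2 / (c * (p + 2))
  have hev := (tendsto_sqExcess_div_sq_mul hM hp hc hedge).eventually_lt_const
    (lt_add_one (2 / (c * (p + 2))))
  obtain ⟨a, ha, hsub⟩ := mem_nhdsLT_iff_exists_Ioo_subset.1 hev
  obtain ⟨b, hb, hbM⟩ := exists_between (max_lt ha hμ₀)
  have hF := continuousOn_sqExcess_div hM hν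
  have h1 : IntervalIntegrable (fun u => sqExcess ν u / meanExcess ν u ^ 2) volume μ₀ b :=
    (hF.mono fun u hu => hu.2.trans_lt (max_lt hμ₀ hbM)).intervalIntegrable
  refine h1.trans ?_
  have h2 : IntervalIntegrable (fun u => (L + 1) * (M - u) ^ (-p)) volume b M := by
    have := (intervalIntegral.intervalIntegrable_rpow' (a := M - b) (b := 0) (r := -p)
      (by linarith)).comp_sub_left M
    simp only [sub_sub_cancel, sub_zero] at this
    exact this.const_mul _
  rw [intervalIntegrable_iff_integrableOn_Ioo_of_le hbM.le] at h2 ⊢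
  refine h2.mono' ((hF.mono fun u hu => hu.2).aestronglyMeasurable measurableSet_Ioo) ?_
  filter_upwards [ae_restrict_mem measurableSet_Ioo] with u hu
  have hu' : sqExcess ν u / meanExcess ν u ^ 2 * (M - u) ^ p < L + 1 :=
    hsub ⟨(le_max_left _ _).trans_lt (hb.trans hu.1), hu.2⟩
  have hpos : 0 < M - u := sub_pos.2 hu.2
  rw [Real.norm_of_nonneg (div_nonneg (sqExcess_nonneg _ _) (sq_nonneg _)), Real.rpow_neg hpos.le,
    ← div_eq_mul_inv, le_div_iff₀ (Real.rpow_pos_of_pos hpos _)]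
  exact hu'.le

lemma eqOn_variance_excess_div (hM : ∀ᵐ y ∂ν, y ≤ M) (hν : ∀ x < M, ν (Set.Ioi x) ≠ 0)
    (hμ₀ : μ₀ < M) :
    Set.EqOn (fun u => sqExcess ν u / meanExcess ν u ^ 2 - 1) (fun w : ℝ =>
      variance (fun x : ℝ => max (x - w) 0) ν / (∫ x, max (x - w) 0 ∂ν) ^ 2) (Set.uIoo μ₀ M) := by
  intro w hw
  rw [Set.uIoo_of_lt hμ₀] at hw
  have hpos := meanExcess_pos hM (hν w hw.2)
  dsimp only
  rw [variance_excess hM, ← meanExcess, sub_div, div_self (pow_pos hpos 2).ne']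

lemma tendsto_varianceRatio_of_lt_one (hM : ∀ᵐ y ∂ν, y ≤ M)
    (hν : ∀ x < M, ν (Set.Ioi x) ≠ 0)
    (hμ₀ : μ₀ < M) (hp : 0 < p) (hp1 : p < 1) (hc : 0 < c)
    (hedge : Tendsto (fun x => meanExcess ν x / (M - x) ^ (p + 1)) (𝓝[<] M) (𝓝 c)) (V₀ : ℝ) :
    Tendsto (varianceRatio ν μ₀ V₀) (𝓝[<] M) (𝓝 ((M - μ₀) + V₀ / meanExcess ν μ₀ +
      ∫ w in μ₀..M, variance (fun x : ℝ => max (x - w) 0) ν / (∫ x, max (x - w) 0 ∂ν) ^ 2)) := by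
  have hint := intervalIntegrable_sqExcess_div hM hν hμ₀ hp hp1 hc hedge
  have hval : (M - μ₀) + V₀ / meanExcess ν μ₀ +
      ∫ w in μ₀..M, variance (fun x : ℝ => max (x - w) 0) ν / (∫ x, max (x - w) 0 ∂ν) ^ 2 =
      varianceRatio ν μ₀ V₀ M := by
    rw [← intervalIntegral.integral_congr_uIoo (eqOn_variance_excess_div hM hν hμ₀),
      intervalIntegral.integral_sub hint intervalIntegrable_const, intervalIntegral.integral_const,
      varianceRatio, smul_eq_mul, mul_one]
    ring
  rw [hval]
  have h1 := intervalIntegral.continuousOn_primitive_interval' hint Set.left_mem_uIcc M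
    Set.right_mem_uIcc
  refine Tendsto.const_add _ (Tendsto.mono_left h1 ?_)
  rw [Set.uIcc_of_le hμ₀.le]
  exact nhdsWithin_le_of_mem (Icc_mem_nhdsLT hμ₀)

lemma tendsto_varianceRatio_of_one_lt (hM : ∀ᵐ y ∂ν, y ≤ M)
    (hν : ∀ x < M, ν (Set.Ioi x) ≠ 0) (hμ₀ : μ₀ < M) (hp1 : 1 < p) (hc : 0 < c)
    (hedge : Tendsto (fun x => meanExcess ν x / (M - x) ^ (p + 1)) (𝓝[<] M) (𝓝 c)) (V₀ : ℝ) :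
    Tendsto (fun w => varianceRatio ν μ₀ V₀ w * (M - w) ^ (p - 1)) (𝓝[<] M)
      (𝓝 (2 / (c * (p + 2)) / (p - 1))) := by
  have hlt : ∀ᶠ x in 𝓝[<] M, x < M := self_mem_nhdsWithin
  refine tendsto_mul_sub_rpow (sub_pos.2 hp1)
    (hlt.mono fun w hw => hasDerivAt_varianceRatio hM hν hμ₀ V₀ hw) ?_
  rw [sub_add_cancel]
  exact tendsto_sqExcess_div_sq_mul hM (by linarith) hc hedge

lemma tendsto_varianceRatio_of_eq_one (hM : ∀ᵐ y ∂ν, y ≤ M)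
    (hν : ∀ x < M, ν (Set.Ioi x) ≠ 0) (hμ₀ : μ₀ < M) (hc : 0 < c)
    (hedge : Tendsto (fun x => meanExcess ν x / (M - x) ^ ((1 : ℝ) + 1)) (𝓝[<] M) (𝓝 c))
    (V₀ : ℝ) :
    Tendsto (fun w => varianceRatio ν μ₀ V₀ w / (-Real.log (M - w))) (𝓝[<] M)
      (𝓝 (2 / (3 * c))) := by
  have hlt : ∀ᶠ x in 𝓝[<] M, x < M := self_mem_nhdsWithin
  refine tendsto_div_of_tendsto_deriv_div_atTop (k' := fun w => (M - w)⁻¹)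
    (hlt.mono fun w hw => hasDerivAt_varianceRatio hM hν hμ₀ V₀ hw)
    (hlt.mono fun w hw => ?_) (hlt.mono fun w hw => inv_pos.2 (sub_pos.2 hw))
    (tendsto_neg_atBot_atTop.comp (Real.tendsto_log_nhdsGT_zero.comp (tendsto_sub_nhdsLT M))) ?_
  · have := (((hasDerivAt_id w).const_sub M).log (sub_pos.2 hw).ne').fun_neg
    simpa [neg_div] using this
  · have := tendsto_sqExcess_div_sq_mul hM one_pos hc hedge
    rw [show 2 / (c * (1 + 2)) = 2 / (3 * c) by ring] at this
    simpa [div_inv_eq_mul] using this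

end Edge

lemma tendsto_meanExcess_mul_rpow {ν : Measure ℝ} {M p c a : ℝ} {g : ℝ → ℝ} (ha : 0 < a)
    (hedge : Tendsto (fun x => meanExcess ν x / (M - x) ^ (p + 1)) (𝓝[<] M) (𝓝 c))
    (hgM : ∀ t, g t < M) (hgt : Tendsto g atTop (𝓝[<] M))
    (hδ : Tendsto (fun t => (M - g t) * t ^ (1 / p)) atTop (𝓝 a)) :
    Tendsto (fun t => meanExcess ν (g t) * t ^ ((p + 1) / p)) atTop (𝓝 (c * a ^ (p + 1))) := by
  have h := (hedge.comp hgt).mul (hδ.rpow_const (p := p + 1) (Or.inl ha.ne'))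
  refine h.congr' ?_
  filter_upwards [eventually_gt_atTop 0] with t ht
  have hpos : 0 < M - g t := sub_pos.2 (hgM t)
  have h1 := Real.rpow_pos_of_pos hpos (p + 1)
  simp only [Function.comp_apply]
  rw [Real.mul_rpow hpos.le (Real.rpow_nonneg ht.le _), ← Real.rpow_mul ht.le,
    show 1 / p * (p + 1) = (p + 1) / p by ring]
  field_simp

section Asymptotics

variable {ν : Measure ℝ} [IsProbabilityMeasure ν] {lam M μ₀ p c : ℝ} {g : ℝ → ℝ}

/-- `M - g(t) ~ (λ p c t) ^ (-1 / p)`: the time needed to reach the reservation price `w` is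
`∫ du / (λ φ(u)) ~ (M - w) ^ (-p) / (λ p c)`. -/
lemma tendsto_sub_mul_rpow (hlam : 0 < lam) (hM : ∀ᵐ y ∂ν, y ≤ M)
    (hν : ∀ x < M, ν (Set.Ioi x) ≠ 0) (hμ₀ : μ₀ < M) (hp : 0 < p) (hc : 0 < c)
    (hedge : Tendsto (fun x => meanExcess ν x / (M - x) ^ (p + 1)) (𝓝[<] M) (𝓝 c))
    (hgM : ∀ t, g t < M) (hgG : ∀ t, ∫ u in μ₀..g t, (lam * meanExcess ν u)⁻¹ = t)
    (hgt : Tendsto g atTop (𝓝[<] M)) :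
    Tendsto (fun t => (M - g t) * t ^ (1 / p)) atTop (𝓝 (1 / (lam * p * c) ^ (1 / p))) := by
  have hlt : ∀ᶠ x in 𝓝[<] M, x < M := self_mem_nhdsWithin
  have hinv : ContinuousOn (fun u => (lam * meanExcess ν u)⁻¹) (Set.Iio M) :=
    (continuous_const.mul (continuous_meanExcess hM)).continuousOn.inv₀ fun x hx =>
      (mul_pos hlam (meanExcess_pos hM (hν x hx))).ne'
  have h1 : Tendsto (fun w => (∫ u in μ₀..w, (lam * meanExcess ν u)⁻¹) * (M - w) ^ p) (𝓝[<] M)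
      (𝓝 ((lam * c)⁻¹ / p)) := by
    refine tendsto_mul_sub_rpow hp
      (hlt.mono fun w hw => hasDerivAt_integral_of_continuousOn_Iio hinv hμ₀ hw) ?_
    refine ((hedge.const_mul lam).inv₀ (by positivity)).congr' ?_
    filter_upwards [hlt] with w hw
    have := Real.rpow_pos_of_pos (sub_pos.2 hw) (p + 1)
    have := meanExcess_pos hM (hν w hw)
    field_simp
  have h2 := (h1.comp hgt).rpow_const (p := 1 / p) (Or.inr (by positivity))
  have h3 : ((lam * c)⁻¹ / p) ^ (1 / p) = 1 / (lam * p * c) ^ (1 / p) := by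
    rw [one_div, one_div, ← Real.inv_rpow (by positivity)]
    congr 1
    field_simp
  rw [h3] at h2
  refine h2.congr' ?_
  filter_upwards [eventually_gt_atTop 0] with t ht
  have hpos : 0 < M - g t := sub_pos.2 (hgM t)
  simp only [Function.comp_apply, hgG]
  rw [Real.mul_rpow ht.le (Real.rpow_nonneg hpos.le _), ← Real.rpow_mul hpos.le,
    mul_one_div_cancel hp.ne', Real.rpow_one, mul_comm]

/-- If `δ t ~ a / t`, then `-log (δ t) ~ log t`: the constant `a` does not matter. -/
lemma tendsto_neg_log_div_log {δ : ℝ → ℝ} {a : ℝ} (ha : 0 < a) (hδ : ∀ t, 0 < δ t)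
    (h : Tendsto (fun t => δ t * t) atTop (𝓝 a)) :
    Tendsto (fun t => -Real.log (δ t) / Real.log t) atTop (𝓝 1) := by
  have h1 : Tendsto (fun t => 1 - Real.log (δ t * t) / Real.log t) atTop (𝓝 (1 - 0)) :=
    tendsto_const_nhds.sub ((h.log ha.ne').div_atTop Real.tendsto_log_atTop)
  rw [sub_zero] at h1
  refine h1.congr' ?_
  filter_upwards [eventually_gt_atTop 1] with t ht
  have := Real.log_pos ht
  rw [Real.log_mul (hδ t).ne' (by linarith)]
  field_simp
  ring

end Asymptotics

/-! ### The three regimes of the variance -/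

section VarianceAsymptotics

variable {ν : Measure ℝ} [IsProbabilityMeasure ν] {lam M μ₀ V₀ p c : ℝ} {g : ℝ → ℝ}

lemma isEquivalent_variance_of_lt_one (hlam : 0 < lam) (hM : ∀ᵐ y ∂ν, y ≤ M)
    (hν : ∀ x < M, ν (Set.Ioi x) ≠ 0) (hμ₀ : μ₀ < M) (hV₀ : 0 ≤ V₀) (hp : 0 < p) (hp1 : p < 1)
    (hc : 0 < c)
    (hedge : Tendsto (fun x => meanExcess ν x / (M - x) ^ (p + 1)) (𝓝[<] M) (𝓝 c))
    (hgM : ∀ t, g t < M) (hgt : Tendsto g atTop (𝓝[<] M))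
    (hδ : Tendsto (fun t => (M - g t) * t ^ (1 / p)) atTop (𝓝 (1 / (lam * p * c) ^ (1 / p)))) :
    (fun t => meanExcess ν (g t) * varianceRatio ν μ₀ V₀ (g t)) ~[atTop] fun t =>
      1 / ((lam * p) ^ ((p + 1) / p) * c ^ (1 / p)) *
        ((M - μ₀) + V₀ / meanExcess ν μ₀ +
          ∫ w in μ₀..M, variance (fun x : ℝ => max (x - w) 0) ν / (∫ x, max (x - w) 0 ∂ν) ^ 2) *
        (1 / t ^ ((p + 1) / p)) := by
  have ha : 0 < 1 / (lam * p * c) ^ (1 / p) := by positivity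
  have h1 := tendsto_meanExcess_mul_rpow ha hedge hgM hgt hδ
  have h2 := (tendsto_varianceRatio_of_lt_one hM hν hμ₀ hp hp1 hc hedge V₀).comp hgt
  have hconst : c * (1 / (lam * p * c) ^ (1 / p)) ^ (p + 1) =
      1 / ((lam * p) ^ ((p + 1) / p) * c ^ (1 / p)) := by
    rw [Real.div_rpow zero_le_one (by positivity), Real.one_rpow, ← Real.rpow_mul (by positivity),
      show 1 / p * (p + 1) = (p + 1) / p by ring, Real.mul_rpow (by positivity) hc.le,
      show c ^ ((p + 1) / p) = c * c ^ (1 / p) by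
        rw [← Real.rpow_one_add' hc.le (by positivity)]; congr 1; field_simp]
    have := Real.rpow_pos_of_pos hc (1 / p)
    have := Real.rpow_pos_of_pos (mul_pos hlam hp) ((p + 1) / p)
    field_simp
  rw [hconst] at h1
  refine isEquivalent_const_mul_of_tendsto ?_ ?_ ?_
  · have h3 : 0 ≤ ∫ w in μ₀..M,
        variance (fun x : ℝ => max (x - w) 0) ν / (∫ x, max (x - w) 0 ∂ν) ^ 2 :=
      intervalIntegral.integral_nonneg hμ₀.le fun w _ =>
        div_nonneg (variance_nonneg _ _) (sq_nonneg _)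
    have h4 : 0 ≤ V₀ / meanExcess ν μ₀ := div_nonneg hV₀ (meanExcess_nonneg _ _)
    have h5 : 0 < M - μ₀ := sub_pos.2 hμ₀
    positivity
  · filter_upwards [eventually_gt_atTop 0] with t ht
    positivity
  · refine (h1.mul h2).congr' ?_
    filter_upwards [eventually_gt_atTop 0] with t ht
    have := Real.rpow_pos_of_pos ht ((p + 1) / p)
    simp only [Function.comp_apply]
    field_simp

lemma isEquivalent_variance_of_eq_one (hlam : 0 < lam) (hM : ∀ᵐ y ∂ν, y ≤ M)
    (hν : ∀ x < M, ν (Set.Ioi x) ≠ 0) (hμ₀ : μ₀ < M) (hc : 0 < c)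
    (hedge : Tendsto (fun x => meanExcess ν x / (M - x) ^ ((1 : ℝ) + 1)) (𝓝[<] M) (𝓝 c))
    (hgM : ∀ t, g t < M) (hgt : Tendsto g atTop (𝓝[<] M))
    (hδ : Tendsto (fun t => (M - g t) * t ^ (1 / (1 : ℝ))) atTop
      (𝓝 (1 / (lam * 1 * c) ^ (1 / (1 : ℝ))))) :
    (fun t => meanExcess ν (g t) * varianceRatio ν μ₀ V₀ (g t)) ~[atTop] fun t =>
      2 / (3 * lam ^ 2 * c ^ 2) * (Real.log t / t ^ 2) := by
  have ha : 0 < 1 / (lam * 1 * c) ^ (1 / (1 : ℝ)) := by positivity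
  have h1 := tendsto_meanExcess_mul_rpow ha hedge hgM hgt hδ
  have h2 := (tendsto_varianceRatio_of_eq_one hM hν hμ₀ hc hedge V₀).comp hgt
  simp only [div_one, Real.rpow_one, mul_one] at hδ ha h1
  have h3 := tendsto_neg_log_div_log ha (fun t => sub_pos.2 (hgM t)) hδ
  have h := h1.mul (h2.mul h3)
  rw [show (1 : ℝ) + 1 = 2 by norm_num, show c * (1 / (lam * c)) ^ (2 : ℝ) * (2 / (3 * c) * 1) =
    2 / (3 * lam ^ 2 * c ^ 2) by rw [Real.rpow_ofNat]; field_simp] at h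
  refine isEquivalent_const_mul_of_tendsto (by positivity) ?_ (h.congr' ?_)
  · filter_upwards [eventually_gt_atTop 1] with t ht
    have := Real.log_pos ht
    positivity
  · have hδ0 : ∀ᶠ t in atTop, Real.log (M - g t) < 0 :=
      (Real.tendsto_log_nhdsGT_zero.comp ((tendsto_sub_nhdsLT M).comp hgt)).eventually_lt_atBot 0
    filter_upwards [eventually_gt_atTop 1, hδ0] with t ht hlog
    have := Real.log_pos ht
    have := hlog.ne
    simp only [Function.comp_apply]
    rw [Real.rpow_ofNat]
    field_simp

lemma isEquivalent_variance_of_one_lt (hlam : 0 < lam) (hM : ∀ᵐ y ∂ν, y ≤ M)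
    (hν : ∀ x < M, ν (Set.Ioi x) ≠ 0) (hμ₀ : μ₀ < M) (hp1 : 1 < p) (hc : 0 < c)
    (hedge : Tendsto (fun x => meanExcess ν x / (M - x) ^ (p + 1)) (𝓝[<] M) (𝓝 c))
    (hgM : ∀ t, g t < M) (hgt : Tendsto g atTop (𝓝[<] M))
    (hδ : Tendsto (fun t => (M - g t) * t ^ (1 / p)) atTop (𝓝 (1 / (lam * p * c) ^ (1 / p)))) :
    (fun t => meanExcess ν (g t) * varianceRatio ν μ₀ V₀ (g t)) ~[atTop] fun t =>
      2 / (p - 1) * (1 / (p + 2)) * (1 / (lam * p * c) ^ (2 / p)) * (1 / t ^ (2 / p)) := by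
  have hp : 0 < p := one_pos.trans hp1
  have hp1' : 0 < p - 1 := sub_pos.2 hp1
  have h1 := (hedge.comp hgt).mul
    ((tendsto_varianceRatio_of_one_lt hM hν hμ₀ hp1 hc hedge V₀).comp hgt)
  have h := h1.mul (hδ.pow 2)
  have hsq : ∀ x : ℝ, 0 ≤ x → (x ^ (1 / p)) ^ 2 = x ^ (2 / p) := fun x hx => by
    rw [← Real.rpow_mul_natCast hx]; congr 1; push_cast; ring
  rw [show c * (2 / (c * (p + 2)) / (p - 1)) * (1 / (lam * p * c) ^ (1 / p)) ^ 2 =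
    2 / (p - 1) * (1 / (p + 2)) * (1 / (lam * p * c) ^ (2 / p)) by
      rw [div_pow, one_pow, hsq _ (by positivity)]; field_simp] at h
  refine isEquivalent_const_mul_of_tendsto (by positivity) ?_ (h.congr' ?_)
  · filter_upwards [eventually_gt_atTop 0] with t ht
    positivity
  · filter_upwards [eventually_gt_atTop 0] with t ht
    have hpos : 0 < M - g t := sub_pos.2 (hgM t)
    have h3 := Real.rpow_pos_of_pos hpos (p - 1)
    have h4 := Real.rpow_pos_of_pos ht (2 / p)
    simp only [Function.comp_apply]
    rw [mul_pow, hsq t ht.le, show p + 1 = p - 1 + 2 by ring, Real.rpow_add hpos, Real.rpow_ofNat]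
    field_simp

end VarianceAsymptotics

end
theorem mainTheorem8 {Ω : Type*} [MeasurableSpace Ω] (P : Measure Ω) [IsProbabilityMeasure P]
    (lam : ℝ) (hlam : 0 < lam)
    (ν ν₀ : Measure ℝ) [IsProbabilityMeasure ν] [IsProbabilityMeasure ν₀]
    (B : BiddingProcess P lam ν ν₀)
    (M : ℝ) (hM : IsLUB {x : ℝ | cdf ν x < 1} M)
    (hν₀ : Integrable (fun x : ℝ => x) ν₀)
    (μ₀ : ℝ) (hμ₀ : μ₀ = ∫ x, x ∂ν₀) (hμ₀_nonneg : 0 ≤ μ₀) (hμ₀_lt : μ₀ < M)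
    (p c : ℝ) (hp : 0 < p) (hc : 0 < c)
    (hedge : Tendsto (fun x : ℝ => tailIntegral ν x / (M - x) ^ (p + 1)) (𝓝[<] M) (𝓝 c)) :
    -- the optimal expected price `μ(t)` is a finite maximum, and it is the mean of `S_t`
    (∀ t : ℝ, 0 ≤ t →
      IsGreatest (B.achievable t) (B.threshold t) ∧
      Integrable (B.optimalSalePrice t) P ∧
      ∫ ω, B.optimalSalePrice t ω ∂P = B.threshold t) ∧
    -- asymptotics of `μ(t)`
    ((fun t : ℝ => B.threshold t - (M - 1 / (lam * p * c) ^ (1 / p) * (1 / t ^ (1 / p))))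
      =o[atTop] (fun t : ℝ => 1 / t ^ (1 / p))) ∧
    -- asymptotics of the variance of `S_t`
    (MemLp (fun x : ℝ => x) 2 ν₀ →
      (∀ t : ℝ, 0 ≤ t → MemLp (B.optimalSalePrice t) 2 P) ∧
      (p < 1 →
        IntervalIntegrable
          (fun w : ℝ => variance (fun x : ℝ => max (x - w) 0) ν / (∫ x, max (x - w) 0 ∂ν) ^ 2)
          volume μ₀ M ∧
        (fun t : ℝ => variance (B.optimalSalePrice t) P) ~[atTop]
          (fun t : ℝ => 1 / ((lam * p) ^ ((p + 1) / p) * c ^ (1 / p)) *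
            ((M - μ₀) + variance (fun x : ℝ => x) ν₀ / tailIntegral ν μ₀ +
              ∫ w in μ₀..M,
                variance (fun x : ℝ => max (x - w) 0) ν / (∫ x, max (x - w) 0 ∂ν) ^ 2) *
            (1 / t ^ ((p + 1) / p)))) ∧
      (p = 1 →
        (fun t : ℝ => variance (B.optimalSalePrice t) P) ~[atTop]
          (fun t : ℝ => 2 / (3 * lam ^ 2 * c ^ 2) * (Real.log t / t ^ 2))) ∧
      (1 < p →
        (fun t : ℝ => variance (B.optimalSalePrice t) P) ~[atTop]
          (fun t : ℝ => 2 / (p - 1) * (1 / (p + 2)) * (1 / (lam * p * c) ^ (2 / p)) *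
            (1 / t ^ (2 / p))))) := by
  have hMae := ae_le_of_isLUB_cdf_lt_one hM
  have hν : ∀ x < M, ν (Set.Ioi x) ≠ 0 := fun x hx =>
    measure_Ioi_ne_zero_of_isLUB_cdf_lt_one hM hx
  simp only [tailIntegral_eq_meanExcess hMae] at hedge ⊢
  obtain ⟨g, hg0, hgmono, hgM, hgd, hgG, hgt⟩ := exists_solution_autonomous
    (b := fun x => lam * meanExcess ν x) (M := M) (C := lam) (x₀ := μ₀)
    (continuous_const.mul (continuous_meanExcess hMae)).continuousOn
    (fun x hx => mul_pos hlam (meanExcess_pos hMae (hν x hx))) hlam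
    (fun x hx => mul_le_mul_of_nonneg_left (meanExcess_le hMae hx.le) hlam.le) hμ₀_lt
  have hmp : MeasurePreserving B.X₀ P ν₀ := B.law_X₀.measurePreserving B.measurable_X₀
  have hX₀ : Integrable B.X₀ P := hmp.integrable_comp_of_integrable hν₀
  have hμ₀' : μ₀ = ∫ ω, B.X₀ ω ∂P := by rw [hμ₀, B.law_X₀.integral_eq]
  have hopt := B.isGreatest_achievable hlam hMae hX₀ hμ₀' hμ₀_nonneg hg0 hgmono hgM hgd
  have hthr : ∀ t, B.threshold t = g (max t 0) := fun t => (hopt t).2.2.csSup_eq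
  have hpol : B.optimalPolicy = {q | g (max q.1 0) ≤ q.2} := by
    simp only [BiddingProcess.optimalPolicy, hthr]
  have hδ := tendsto_sub_mul_rpow hlam hMae hν hμ₀_lt hp hc hedge hgM hgG hgt
  refine ⟨fun t _ => ?_, ?_, fun hsq => ?_⟩
  · rw [BiddingProcess.optimalSalePrice, hpol, hthr]
    exact ⟨(hopt t).2.2, (hopt t).1, (hopt t).2.1⟩
  · rw [isLittleO_iff_tendsto' (by
      filter_upwards [eventually_gt_atTop 0] with t ht h
      exact absurd h (by positivity))]
    have h := hδ.const_sub (1 / (lam * p * c) ^ (1 / p))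
    rw [sub_self] at h
    refine h.congr' ?_
    filter_upwards [eventually_gt_atTop 0] with t ht
    have := Real.rpow_pos_of_pos ht (1 / p)
    rw [hthr, max_eq_left ht.le]
    field_simp
    ring
  · have hX₀sq : MemLp B.X₀ 2 P := hsq.comp_measurePreserving hmp
    have hV₀ : variance (fun x : ℝ => x) ν₀ = variance B.X₀ P := B.law_X₀.variance_eq.symm
    have hmom := B.integral_sq_salePrice hlam hMae hν hX₀sq hμ₀' hμ₀_nonneg hμ₀_lt hg0 hgmono hgM hgd
    have hL2 : ∀ t, MemLp (B.optimalSalePrice t) 2 P := fun t => by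
      rw [BiddingProcess.optimalSalePrice, hpol,
        memLp_two_iff_integrable_sq (hopt t).1.aestronglyMeasurable]
      exact (hmom t).1
    have hvar : (fun t => meanExcess ν (g t) * varianceRatio ν μ₀ (variance B.X₀ P) (g t))
        =ᶠ[atTop] fun t => variance (B.optimalSalePrice t) P := by
      filter_upwards [eventually_ge_atTop 0] with t ht
      rw [variance_eq_sub (hL2 t), BiddingProcess.optimalSalePrice, hpol, (hopt t).2.1]
      have := (hmom t).2
      rw [max_eq_left ht] at this ⊢
      simp only [Pi.pow_apply]
      rw [this, add_sub_cancel_right]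
    have hV₀nn : 0 ≤ variance B.X₀ P := variance_nonneg _ _
    refine ⟨fun t _ => hL2 t, fun hp1 => ⟨?_, ?_⟩, fun hp1 => ?_, fun hp1 => ?_⟩
    · exact ((intervalIntegrable_sqExcess_div hMae hν hμ₀_lt hp hp1 hc hedge).sub
        intervalIntegrable_const).congr_uIoo (eqOn_variance_excess_div hMae hν hμ₀_lt)
    · rw [hV₀]
      exact (isEquivalent_variance_of_lt_one hlam hMae hν hμ₀_lt hV₀nn hp hp1 hc hedge hgM hgt
        hδ).congr_left hvar
    · subst hp1
      exact (isEquivalent_variance_of_eq_one hlam hMae hν hμ₀_lt hc hedge hgM hgt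
        hδ).congr_left hvar
    · exact (isEquivalent_variance_of_one_lt hlam hMae hν hμ₀_lt hp1 hc hedge hgM hgt
        hδ).congr_left hvar
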